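/- Let $\varphi:(0,\infty)\to(0,\infty)$ satisfy: (i) $\varphi\in C^1((0,\infty))$; (ii) $(s\varphi(s))'>0$ for all $s>0$; (iii) the range of $s\mapsto s\varphi(s)$ is $(0,\infty)$; (iv) there are $C_1,C_2>0$, $r>-1$ and $s_0>0$ with $C_1s^r\le (s\varphi(s))'\le C_2s^r$ for $s\in(0,s_0)$, and if $r=0$ then moreover the finite limit $\lim_{s\to0^+}\varphi(s)>0$ exists and $\lim_{s\to0^+}s\varphi'(s)=0$; (v) there is $s_1>s_0$ such that $\varphi'\ge0$ on $[s_1,\infty)$ or $\varphi'\le0$ on $[s_1,\infty)$; (vi) $s\mapsto|s\varphi'(s)/\varphi(s)|$ is non-decreasing on $(0,\infty)$. Define $\Lambda$ on $(0,\infty)$ by $$\Lambda\bigl(s\sqrt{\varphi(s)}\bigr)=-\frac{s\varphi'(s)}{s\varphi'(s)+2\varphi(s)}\quad(s>0),\qquad \Lambda_\infty^2:=\sup_{t>0}\Lambda^2(t).$$ Let $-\infty\le a<b\le+\infty$, let $m\ge1$, and let $\mathscr A(x)=\{a_{hk}(x)\}$, $x\in(a,b)$, be an $m\times m$ matrix with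 real entries in $L^1_{\mathrm{loc}}((a,b))$ such that, for almost every $x\in(a,b)$, $\mathscr A(x)$ is symmetric and $\langle\mathscr A(x)\xi,\xi\rangle>0$ for all $\xi\in\mathbb R^m\setminus\{0\}$. The operator $Au=(\mathscr A(x)u')'$ is called $L^\Phi$-dissipative (where $\Phi(s)=\int_0^s\sigma\varphi(\sigma)\,d\sigma$) if $$\operatorname{Re}\int_a^b\bigl\langle \mathscr A u',(\varphi(|u|)u)'\bigr\rangle\,dx\ge0$$ for every $u:(a,b)\to\mathbb C^m$ of class $C^1$ with compact support in $(a,b)$ such that $\varphi(|u|)u$ (set to be $0$ where $u=0$) is also of class $C^1$ with compact support in $(a,b)$. Then $A$ is $L^\Phi$-dissipative if and only if $$\Lambda_\infty^2\,(\mu_1(x)+\mu_m(x))^2\le4\,\mu_1(x)\mu_m(x)\quad\text{for almost every }x\in(a,b),$$ where $\mu_1(x)$ and $\mu_m(x)$ are the smallest and the largest eigenvalues of $\mathscr A(x)$. In the particular case $m=2$ this condition is equivalent to $$\Lambda_\infty^2\,(\operatorname{tr}\mathscr A(x))^2\le4\det\mathscr A(x)\quad\text{for almost every }x\in(a,b).$$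 -/

import Mathlib

open Set Filter Topology MeasureTheory

noncomputable section

namespace PhiDissipativity

/-- The standing conditions on the weight `φ`, a positive function on `(0, ∞)`; the values of `φ`
outside `(0, ∞)` play no role. -/
structure AdmissibleWeight (φ : ℝ → ℝ) : Prop where
  pos : ∀ s, 0 < s → 0 < φ s
  contDiffOn : ContDiffOn ℝ 1 φ (Ioi 0)
  deriv_pos : ∀ s, 0 < s → 0 < deriv (fun σ => σ * φ σ) s
  range_eq : (fun s => s * φ s) '' Ioi 0 = Ioi 0
  behaviour : ∃ r s₀ C₁ C₂ : ℝ, -1 < r ∧ 0 < s₀ ∧ 0 < C₁ ∧ 0 < C₂ ∧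
    (∀ s ∈ Ioo 0 s₀, C₁ * s ^ r ≤ deriv (fun σ => σ * φ σ) s ∧
      deriv (fun σ => σ * φ σ) s ≤ C₂ * s ^ r) ∧
    (r = 0 → (∃ φ₀ : ℝ, 0 < φ₀ ∧ Tendsto φ (𝓝[>] 0) (𝓝 φ₀)) ∧
      Tendsto (fun s => s * deriv φ s) (𝓝[>] 0) (𝓝 0)) ∧
    ∃ s₁, s₀ < s₁ ∧ ((∀ s, s₁ ≤ s → 0 ≤ deriv φ s) ∨ (∀ s, s₁ ≤ s → deriv φ s ≤ 0))
  monotoneOn_ratio : MonotoneOn (fun s => |s * deriv φ s / φ s|) (Ioi 0)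

/-- The inverse of the bijection `s ↦ s √(φ s)` of `(0, ∞)` onto itself (see
`AdmissibleWeight.bijOn`). -/
def invWeight (φ : ℝ → ℝ) : ℝ → ℝ :=
  Function.invFunOn (fun s => s * √(φ s)) (Ioi 0)

/-- The function `Λ` on `(0, ∞)`: `Λ (s √(φ s)) = - s φ'(s) / (s φ'(s) + 2 φ(s))` for `s > 0`
(see `Lambda_apply`). -/
def Lambda (φ : ℝ → ℝ) (t : ℝ) : ℝ :=
  -(invWeight φ t * deriv φ (invWeight φ t)) /
    (invWeight φ t * deriv φ (invWeight φ t) + 2 * φ (invWeight φ t))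

/-- `Λ_∞² = sup_{t > 0} Λ²(t)`; the set is bounded, see `bddAbove_Lambda_sq`. -/
def LambdaInftySq (φ : ℝ → ℝ) : ℝ :=
  sSup ((fun t => Lambda φ t ^ 2) '' Ioi 0)

theorem AdmissibleWeight.strictMonoOn {φ : ℝ → ℝ} (h : AdmissibleWeight φ) :
    StrictMonoOn (fun s => s * φ s) (Ioi 0) := by
  refine strictMonoOn_of_deriv_pos (convex_Ioi 0)
    (continuousOn_id.mul h.contDiffOn.continuousOn) ?_
  intro s hs
  rw [interior_Ioi] at hs
  exact h.deriv_pos s hs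

theorem AdmissibleWeight.bijOn {φ : ℝ → ℝ} (h : AdmissibleWeight φ) :
    BijOn (fun s => s * √(φ s)) (Ioi 0) (Ioi 0) := by
  have hsq : ∀ s, 0 < s → (s * √(φ s)) ^ 2 = s * (s * φ s) := by
    intro s hs
    rw [mul_pow, Real.sq_sqrt (h.pos s hs).le]; ring
  have hpos : ∀ s, 0 < s → 0 < s * √(φ s) := fun s hs =>
    mul_pos hs (Real.sqrt_pos.2 (h.pos s hs))
  have hmono : StrictMonoOn (fun s => s * √(φ s)) (Ioi 0) := by
    intro a ha b hb hab
    refine lt_of_pow_lt_pow_left₀ 2 (hpos b hb).le ?_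
    simp only [hsq a ha, hsq b hb]
    exact mul_lt_mul hab (h.strictMonoOn ha hb hab).le
      (mul_pos ha (h.pos a ha)) (le_of_lt hb)
  refine ⟨fun s hs => hpos s hs, hmono.injOn, ?_⟩
  intro t ht
  have ht' : (0 : ℝ) < t := ht
  obtain ⟨a, ha, hat⟩ : t ∈ (fun s => s * φ s) '' Ioi 0 := by rw [h.range_eq]; exact ht
  have ha' : (0 : ℝ) < a := ha
  simp only at hat
  have hsub : uIcc a t ⊆ Ioi 0 := fun s hs => lt_of_lt_of_le (lt_min ha' ht') hs.1
  have hcont : ContinuousOn (fun s => s * √(φ s)) (uIcc a t) :=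
    continuousOn_id.mul ((h.contDiffOn.continuousOn.mono hsub).sqrt)
  have hmem : t ∈ uIcc (a * √(φ a)) (t * √(φ t)) := by
    have h1 := hsq a ha'
    have h2 := hsq t ht'
    rw [hat] at h1
    rcases le_total a t with hle | hle
    · have h3 : t ≤ t * φ t := by
        have := h.strictMonoOn.monotoneOn ha ht hle
        simpa [hat] using this
      refine mem_uIcc.2 (Or.inl ⟨?_, ?_⟩)
      · exact (sq_le_sq₀ (by positivity) (by positivity)).1 (by nlinarith)
      · exact (sq_le_sq₀ (by positivity) (by positivity)).1 (by nlinarith)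
    · have h3 : t * φ t ≤ t := by
        have := h.strictMonoOn.monotoneOn ht ha hle
        simpa [hat] using this
      refine mem_uIcc.2 (Or.inr ⟨?_, ?_⟩)
      · exact (sq_le_sq₀ (by positivity) (by positivity)).1 (by nlinarith)
      · exact (sq_le_sq₀ (by positivity) (by positivity)).1 (by nlinarith)
  obtain ⟨s, hs, hst⟩ := intermediate_value_uIcc hcont hmem
  exact ⟨s, hsub hs, hst⟩

theorem Lambda_apply {φ : ℝ → ℝ} (h : AdmissibleWeight φ) {s : ℝ} (hs : 0 < s) :
    Lambda φ (s * √(φ s)) = -(s * deriv φ s) / (s * deriv φ s + 2 * φ s) := by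
  have : invWeight φ (s * √(φ s)) = s :=
    h.bijOn.invOn_invFunOn.1 hs
  simp only [Lambda, this]

theorem bddAbove_Lambda_sq {φ : ℝ → ℝ} (h : AdmissibleWeight φ) :
    BddAbove ((fun t => Lambda φ t ^ 2) '' Ioi 0) := by
  refine ⟨1, ?_⟩
  rintro _ ⟨t, ht, rfl⟩
  obtain ⟨s, hs, rfl⟩ := h.bijOn.surjOn ht
  have hs' : (0 : ℝ) < s := hs
  have hd : DifferentiableAt ℝ φ s :=
    (h.contDiffOn.differentiableOn one_ne_zero).differentiableAt (Ioi_mem_nhds hs')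
  have h1 := h.deriv_pos s hs
  have h2 : deriv (fun σ => σ * φ σ) s = φ s + s * deriv φ s := by
    have := (hasDerivAt_id' s).fun_mul hd.hasDerivAt
    simpa using this.deriv
  rw [h2] at h1
  have h3 := h.pos s hs
  simp only [Lambda_apply h hs']
  rw [div_pow, div_le_one (by nlinarith)]
  nlinarith

/-- `u ∈ [C¹_c(I)]^m`; functions with compact support in `I` are extended by zero to `ℝ`. -/
def TestFunction {m : ℕ} (I : Set ℝ) (u : ℝ → EuclideanSpace ℂ (Fin m)) : Prop :=
  ContDiff ℝ 1 u ∧ HasCompactSupport u ∧ tsupport u ⊆ I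

/-- The operator `A u = (𝒜 u')'` on the open set `I ⊆ ℝ` is `L^Φ`-dissipative:
`Re ∫_I ⟨𝒜 u', (φ(|u|) u)'⟩ dx ≥ 0` for every `u ∈ [C¹_c(I)]^m` such that `φ(|u|) u ∈ [C¹_c(I)]^m`.
The Hermitian product is
antilinear in the second argument, which is the first argument of `inner`. -/
def LPhiDissipative {m : ℕ} (φ : ℝ → ℝ) (I : Set ℝ) (𝒜 : ℝ → Matrix (Fin m) (Fin m) ℂ) : Prop :=
  ∀ u : ℝ → EuclideanSpace ℂ (Fin m), TestFunction I u →
    TestFunction I (fun x => φ ‖u x‖ • u x) →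
    0 ≤ (∫ x in I, inner ℂ (deriv (fun y => φ ‖u y‖ • u y) x)
      (Matrix.toEuclideanCLM (𝕜 := ℂ) (𝒜 x) (deriv u x))).re

/-- The smallest eigenvalue of a real symmetric matrix of positive size. -/
def minEigenvalue {m : ℕ} (M : Matrix (Fin m) (Fin m) ℝ) : ℝ :=
  sInf {μ : ℝ | Module.End.HasEigenvalue (Matrix.toLin' M) μ}

/-- The largest eigenvalue of a real symmetric matrix of positive size. -/
def maxEigenvalue {m : ℕ} (M : Matrix (Fin m) (Fin m) ℝ) : ℝ :=
  sSup {μ : ℝ | Module.End.HasEigenvalue (Matrix.toLin' M) μ}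

/-- The bounded or unbounded open interval `(a, b) ⊆ ℝ`, with endpoints in `[-∞, ∞]`. -/
def openInterval (a b : EReal) : Set ℝ := {x : ℝ | a < (x : EReal) ∧ (x : EReal) < b}

end PhiDissipativity

end

/-!
Regard `ℂᵐ` as a real inner product space. Dissipativity is equivalent to nonnegativity, for
almost every `x` and all `v ≠ 0` and `ξ`, of the pairing of `𝒜(x) ξ` with the derivative of
`v ↦ φ(|v|) v` at `v` in the direction `ξ`. Sufficiency is the chain rule. For necessity one
perturbs a test map that is constantly `v` near a point by `N⁻¹ sin(N² x + ϑ) η(x) ξ`: divided by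
`N²`, the sum of the energies for the phases `0` and `π / 2` tends to the integral of `η²` times
the pairing. A path to `v` along which `u` and `φ(|u|) u` are both `C¹` comes from inverting
`s ↦ s + s φ(s)`.

Minimizing the pairing over the direction of `v`, the extremal direction being a bisector of `ξ`
and `± 𝒜 ξ`, turns the condition into `|s φ'(s)| |ξ| |𝒜 ξ| ≤ (s φ'(s) + 2 φ(s)) ⟨𝒜 ξ, ξ⟩`. The
largest value of `|ξ| |𝒜 ξ| / ⟨𝒜 ξ, ξ⟩` is Kantorovich's constant `(μ₁ + μ_m) / (2 √(μ₁ μ_m))`,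
attained at `√μ_m e₁ + √μ₁ e_m` for unit eigenvectors `e₁` and `e_m`.
-/

noncomputable section

namespace PhiDissipativity

open scoped RealInnerProductSpace

section Weight

variable {φ : ℝ → ℝ}

/-- A positive `C¹` weight `φ` on `(0, ∞)` for which `s φ(s)` is nondecreasing and tends to `0` as
`s → 0⁺`. -/
structure RegularWeight (φ : ℝ → ℝ) : Prop where
  pos : ∀ s, 0 < s → 0 < φ s
  contDiffOn : ContDiffOn ℝ 1 φ (Ioi 0)
  deriv_nonneg : ∀ s, 0 < s → 0 ≤ deriv (fun σ => σ * φ σ) s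
  tendsto_zero : Tendsto (fun s => s * φ s) (𝓝[>] 0) (𝓝 0)

theorem AdmissibleWeight.regularWeight (h : AdmissibleWeight φ) : RegularWeight φ where
  pos := h.pos
  contDiffOn := h.contDiffOn
  deriv_nonneg s hs := (h.deriv_pos s hs).le
  tendsto_zero := by
    have hbdd : BddBelow ((fun s => s * φ s) '' Ioi 0) := by
      rw [h.range_eq]; exact bddBelow_Ioi
    simpa only [h.range_eq, csInf_Ioi] using h.strictMonoOn.monotoneOn.tendsto_nhdsGT hbdd

theorem mul_sqrt_eq_sqrt_mul_mul {s : ℝ} (hs : 0 ≤ s) (x : ℝ) : s * √x = √(s * (s * x)) := by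
  rw [← mul_assoc, Real.sqrt_mul (mul_self_nonneg s), Real.sqrt_mul_self hs]

namespace RegularWeight

theorem differentiableAt (h : RegularWeight φ) {s : ℝ} (hs : 0 < s) : DifferentiableAt ℝ φ s :=
  (h.contDiffOn.differentiableOn one_ne_zero).differentiableAt (Ioi_mem_nhds hs)

theorem hasDerivAt_mul (h : RegularWeight φ) {s : ℝ} (hs : 0 < s) :
    HasDerivAt (fun σ => σ * φ σ) (φ s + s * deriv φ s) s := by
  simpa using (hasDerivAt_id' s).fun_mul (h.differentiableAt hs).hasDerivAt

theorem add_mul_deriv_nonneg (h : RegularWeight φ) {s : ℝ} (hs : 0 < s) :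
    0 ≤ φ s + s * deriv φ s :=
  (h.hasDerivAt_mul hs).deriv ▸ h.deriv_nonneg s hs

theorem mul_deriv_add_two_mul_pos (h : RegularWeight φ) {s : ℝ} (hs : 0 < s) :
    0 < s * deriv φ s + 2 * φ s := by
  linarith [h.add_mul_deriv_nonneg hs, h.pos s hs]

theorem abs_mul_deriv_le (h : RegularWeight φ) {s : ℝ} (hs : 0 < s) :
    |s * deriv φ s| ≤ s * deriv φ s + 2 * φ s :=
  abs_le.2 ⟨by linarith [h.add_mul_deriv_nonneg hs], by linarith [h.pos s hs]⟩

theorem continuousOn_mul (h : RegularWeight φ) : ContinuousOn (fun s => s * φ s) (Ioi 0) :=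
  continuousOn_id.mul h.contDiffOn.continuousOn

theorem monotoneOn_mul (h : RegularWeight φ) : MonotoneOn (fun s => s * φ s) (Ioi 0) := by
  refine monotoneOn_of_deriv_nonneg (convex_Ioi 0) h.continuousOn_mul ?_ ?_ <;> rw [interior_Ioi]
  · exact fun s hs => (h.hasDerivAt_mul hs).differentiableAt.differentiableWithinAt
  · exact h.deriv_nonneg

theorem mul_sqrt_pos (h : RegularWeight φ) {s : ℝ} (hs : 0 < s) : 0 < s * √(φ s) :=
  mul_pos hs (Real.sqrt_pos.2 (h.pos s hs))

theorem strictMonoOn_mul_sqrt (h : RegularWeight φ) :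
    StrictMonoOn (fun s => s * √(φ s)) (Ioi 0) := by
  intro a (ha : 0 < a) b (hb : 0 < b) hab
  simp only [mul_sqrt_eq_sqrt_mul_mul ha.le, mul_sqrt_eq_sqrt_mul_mul hb.le]
  refine Real.sqrt_lt_sqrt (mul_pos ha (mul_pos ha (h.pos a ha))).le ?_
  exact mul_lt_mul hab (h.monotoneOn_mul ha hb hab.le) (mul_pos ha (h.pos a ha)) hb.le

theorem tendsto_mul_sqrt_nhdsGT (h : RegularWeight φ) :
    Tendsto (fun s => s * √(φ s)) (𝓝[>] 0) (𝓝 0) := by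
  have hid : Tendsto (fun s : ℝ => s) (𝓝[>] 0) (𝓝 0) := tendsto_id.mono_left nhdsWithin_le_nhds
  have hsqrt := (hid.mul h.tendsto_zero).sqrt
  rw [mul_zero, Real.sqrt_zero] at hsqrt
  refine hsqrt.congr' (eventually_mem_nhdsWithin.mono fun s (hs : 0 < s) => ?_)
  exact (mul_sqrt_eq_sqrt_mul_mul hs.le _).symm

theorem tendsto_mul_sqrt_atTop (h : RegularWeight φ) :
    Tendsto (fun s => s * √(φ s)) atTop atTop := by
  have hlower : Tendsto (fun s => √(s * (1 * φ 1))) atTop atTop :=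
    Real.tendsto_sqrt_atTop.comp <| tendsto_id.atTop_mul_const (by simpa using h.pos 1 one_pos)
  refine tendsto_atTop_mono' _ ?_ hlower
  filter_upwards [eventually_ge_atTop 1] with s hs
  have hs0 : 0 < s := one_pos.trans_le hs
  rw [mul_sqrt_eq_sqrt_mul_mul hs0.le]
  exact Real.sqrt_le_sqrt <|
    mul_le_mul_of_nonneg_left (h.monotoneOn_mul (mem_Ioi.2 one_pos) hs0 hs) hs0.le

theorem bijOn_mul_sqrt (h : RegularWeight φ) :
    BijOn (fun s => s * √(φ s)) (Ioi 0) (Ioi 0) := by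
  refine ⟨fun s hs => h.mul_sqrt_pos hs, h.strictMonoOn_mul_sqrt.injOn, ?_⟩
  exact isPreconnected_Ioi.intermediate_value_Ioi (l₁ := 𝓝[>] 0) inf_le_right
    (le_principal_iff.2 (Ioi_mem_atTop 0)) (continuousOn_id.mul h.contDiffOn.continuousOn.sqrt)
    h.tendsto_mul_sqrt_nhdsGT h.tendsto_mul_sqrt_atTop

theorem Lambda_mul_sqrt (h : RegularWeight φ) {s : ℝ} (hs : 0 < s) :
    Lambda φ (s * √(φ s)) = -(s * deriv φ s) / (s * deriv φ s + 2 * φ s) := by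
  have hinv : invWeight φ (s * √(φ s)) = s := h.bijOn_mul_sqrt.invOn_invFunOn.1 hs
  simp only [Lambda, hinv]

theorem Lambda_mul_sqrt_sq_mul_sq_le_iff (h : RegularWeight φ) {s P R : ℝ} (hs : 0 < s)
    (hP : 0 ≤ P) (hR : 0 ≤ R) :
    Lambda φ (s * √(φ s)) ^ 2 * P ^ 2 ≤ R ^ 2 ↔
      |s * deriv φ s| * P ≤ (s * deriv φ s + 2 * φ s) * R := by
  have hd := h.mul_deriv_add_two_mul_pos hs
  rw [h.Lambda_mul_sqrt hs, ← mul_pow, sq_le_sq, abs_mul, abs_div, abs_neg, abs_of_pos hd,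
    abs_of_nonneg hP, abs_of_nonneg hR, div_mul_eq_mul_div, div_le_iff₀ hd, mul_comm R]

theorem isLUB_LambdaInftySq (h : RegularWeight φ) :
    IsLUB ((fun t => Lambda φ t ^ 2) '' Ioi 0) (LambdaInftySq φ) := by
  refine isLUB_csSup (nonempty_Ioi.image _) ⟨1, ?_⟩
  rintro _ ⟨t, ht, rfl⟩
  obtain ⟨s, hs, rfl⟩ := h.bijOn_mul_sqrt.surjOn ht
  simpa using (h.Lambda_mul_sqrt_sq_mul_sq_le_iff hs zero_le_one zero_le_one).2
    (by simpa using h.abs_mul_deriv_le hs)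

theorem LambdaInftySq_mul_sq_le_iff (h : RegularWeight φ) {P R : ℝ} (hP : 0 ≤ P) (hR : 0 ≤ R) :
    LambdaInftySq φ * P ^ 2 ≤ R ^ 2 ↔
      ∀ s, 0 < s → |s * deriv φ s| * P ≤ (s * deriv φ s + 2 * φ s) * R := by
  rcases hP.eq_or_lt with rfl | hP'
  · simpa [sq_nonneg] using fun s hs => mul_nonneg (h.mul_deriv_add_two_mul_pos hs).le hR
  rw [← le_div_iff₀ (by positivity), isLUB_le_iff h.isLUB_LambdaInftySq]
  rw [← h.bijOn_mul_sqrt.image_eq]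
  simp only [mem_upperBounds, forall_mem_image, le_div_iff₀ (pow_pos hP' 2)]
  exact forall₂_congr fun s hs => h.Lambda_mul_sqrt_sq_mul_sq_le_iff hs hP hR

end RegularWeight

end Weight

section RadialMap

variable {V : Type*} [NormedAddCommGroup V] [InnerProductSpace ℝ V] {φ : ℝ → ℝ}

/-- The map `v ↦ φ(|v|) v`, which sends `u` to the test map `φ(|u|) u` of the dissipativity
condition. -/
def radialMap (φ : ℝ → ℝ) (v : V) : V := φ ‖v‖ • v

/-- The integrand `⟨𝒜 u', (φ(|u|) u)'⟩` at a point where `𝒜 = T`, `u = v` and `u' = ξ`. -/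
def energyForm (φ : ℝ → ℝ) (T : V →L[ℝ] V) (v ξ : V) : ℝ := ⟪fderiv ℝ (radialMap φ) v ξ, T ξ⟫

@[simp]
theorem radialMap_zero : radialMap φ (0 : V) = 0 := smul_zero _

theorem RegularWeight.contDiffAt_radialMap (h : RegularWeight φ) {v : V} (hv : v ≠ 0) :
    ContDiffAt ℝ 1 (radialMap φ) v :=
  ((h.contDiffOn.contDiffAt (Ioi_mem_nhds (norm_pos_iff.2 hv))).comp v (contDiffAt_norm ℝ hv)).smul
    contDiffAt_id

theorem RegularWeight.fderiv_radialMap_apply (h : RegularWeight φ) {v : V} (hv : v ≠ 0) (ξ : V) :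
    fderiv ℝ (radialMap φ) v ξ = φ ‖v‖ • ξ + (deriv φ ‖v‖ / ‖v‖ * ⟪v, ξ⟫) • v := by
  have hs : 0 < ‖v‖ := norm_pos_iff.2 hv
  have hnorm : HasFDerivAt (fun v : V => ‖v‖) (‖v‖⁻¹ • innerSL ℝ v) v := by
    have := (hasStrictFDerivAt_norm_sq v).hasFDerivAt.sqrt (pow_pos hs 2).ne'
    simp only [Real.sqrt_sq (norm_nonneg _)] at this
    convert this using 1
    ext ξ
    simp
    field_simp
  have hφ := (h.differentiableAt hs).hasDerivAt.comp_hasFDerivAt v hnorm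
  have hradial : HasFDerivAt (radialMap φ) _ v := hφ.smul (hasFDerivAt_id v)
  rw [hradial.fderiv]
  simp [div_eq_mul_inv, mul_assoc]

theorem RegularWeight.continuousOn_fderiv_radialMap (h : RegularWeight φ) :
    ContinuousOn (fderiv ℝ (radialMap φ : V → V)) {0}ᶜ :=
  ContDiffOn.continuousOn_fderiv_of_isOpen
    (fun _ hv => (h.contDiffAt_radialMap hv).contDiffWithinAt) isOpen_compl_singleton le_rfl

theorem energyForm_smul (T : V →L[ℝ] V) (v ξ : V) (c : ℝ) :
    energyForm φ T v (c • ξ) = c ^ 2 * energyForm φ T v ξ := by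
  simp only [energyForm, map_smul, real_inner_smul_left, real_inner_smul_right]
  ring

theorem RegularWeight.energyForm_smul_unit (h : RegularWeight φ) (T : V →L[ℝ] V) {s : ℝ}
    (hs : 0 < s) {v : V} (hv : ‖v‖ = 1) (ξ : V) :
    energyForm φ T (s • v) ξ = φ s * ⟪ξ, T ξ⟫ + s * deriv φ s * (⟪v, ξ⟫ * ⟪v, T ξ⟫) := by
  have hnorm : ‖s • v‖ = s := by rw [norm_smul, hv, mul_one, Real.norm_of_nonneg hs.le]
  have hne : s • v ≠ 0 := norm_pos_iff.1 (hnorm.symm ▸ hs)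
  rw [energyForm, h.fderiv_radialMap_apply hne, hnorm]
  simp only [inner_add_left, real_inner_smul_left]
  field_simp

theorem RegularWeight.forall_energyForm_nonneg_iff (h : RegularWeight φ) (T : V →L[ℝ] V) (ξ : V) :
    (∀ v, v ≠ 0 → 0 ≤ energyForm φ T v ξ) ↔
      ∀ s, 0 < s → ∀ v : V, ‖v‖ = 1 →
        0 ≤ φ s * ⟪ξ, T ξ⟫ + s * deriv φ s * (⟪v, ξ⟫ * ⟪v, T ξ⟫) := by
  constructor
  · intro hnonneg s hs v hv
    rw [← h.energyForm_smul_unit T hs hv]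
    exact hnonneg _ (smul_ne_zero hs.ne' (norm_pos_iff.1 (hv.symm ▸ one_pos)))
  · intro hnonneg v hv
    have hpolar : ‖v‖ • ‖v‖⁻¹ • v = v := smul_inv_smul₀ (norm_ne_zero_iff.2 hv) v
    have hunit : ‖‖v‖⁻¹ • v‖ = 1 := by
      rw [norm_smul, norm_inv, norm_norm, inv_mul_cancel₀ (norm_ne_zero_iff.2 hv)]
    rw [← hpolar, h.energyForm_smul_unit T (norm_pos_iff.2 hv) hunit]
    exact hnonneg _ (norm_pos_iff.2 hv) _ hunit

end RadialMap

section InnerProduct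

variable {V : Type*} [NormedAddCommGroup V] [InnerProductSpace ℝ V]

theorem abs_two_mul_inner_mul_inner_sub_le (v ξ η : V) :
    |2 * (⟪v, ξ⟫ * ⟪v, η⟫) - ‖v‖ ^ 2 * ⟪ξ, η⟫| ≤ ‖v‖ ^ 2 * (‖ξ‖ * ‖η‖) := by
  -- up to the factor `‖v‖²`, the vector `2 ⟪v, ξ⟫ v - ‖v‖² ξ` is a reflection of `ξ`
  have hnorm : ‖(2 * ⟪v, ξ⟫) • v - ‖v‖ ^ 2 • ξ‖ = ‖v‖ ^ 2 * ‖ξ‖ := by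
    rw [← sq_eq_sq₀ (norm_nonneg _) (by positivity), norm_sub_sq_real]
    simp only [norm_smul, real_inner_smul_left, real_inner_smul_right, mul_pow, Real.norm_eq_abs,
      sq_abs]
    ring
  calc |2 * (⟪v, ξ⟫ * ⟪v, η⟫) - ‖v‖ ^ 2 * ⟪ξ, η⟫|
      = |⟪(2 * ⟪v, ξ⟫) • v - ‖v‖ ^ 2 • ξ, η⟫| := by
        simp only [inner_sub_left, real_inner_smul_left, mul_assoc]
    _ ≤ ‖(2 * ⟪v, ξ⟫) • v - ‖v‖ ^ 2 • ξ‖ * ‖η‖ := abs_real_inner_le_norm _ _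
    _ = ‖v‖ ^ 2 * (‖ξ‖ * ‖η‖) := by rw [hnorm, mul_assoc]

theorem norm_smul_add_norm_smul_sq {ξ η : V} {ε : ℝ} (hε : ε ^ 2 = 1) :
    ‖‖η‖ • ξ + (ε * ‖ξ‖) • η‖ ^ 2 = 2 * (‖ξ‖ * ‖η‖) * (‖ξ‖ * ‖η‖ + ε * ⟪ξ, η⟫) := by
  rw [norm_add_sq_real]
  simp only [norm_smul, real_inner_smul_left, real_inner_smul_right, mul_pow, Real.norm_eq_abs,
    sq_abs, hε]
  ring

theorem exists_unit_two_mul_inner_mul_inner_eq {ξ η : V} {ε : ℝ} (hε : ε ^ 2 = 1)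
    (h : 0 < ‖ξ‖ * ‖η‖ * (‖ξ‖ * ‖η‖ + ε * ⟪ξ, η⟫)) :
    ∃ v : V, ‖v‖ = 1 ∧ 2 * (⟪v, ξ⟫ * ⟪v, η⟫) = ⟪ξ, η⟫ + ε * (‖ξ‖ * ‖η‖) := by
  -- `v` is the bisector of the directions of `ξ` and `ε η`
  have hw2 := norm_smul_add_norm_smul_sq (ξ := ξ) (η := η) hε
  generalize hw : ‖η‖ • ξ + (ε * ‖ξ‖) • η = w at hw2
  have hw0 : ‖w‖ ≠ 0 := by
    intro h0
    rw [h0] at hw2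
    linarith
  have hwξη : ⟪w, ξ⟫ * ⟪w, η⟫ = ‖w‖ ^ 2 * ((⟪ξ, η⟫ + ε * (‖ξ‖ * ‖η‖)) / 2) := by
    rw [hw2, ← hw]
    simp only [inner_add_left, real_inner_smul_left, real_inner_self_eq_norm_sq,
      real_inner_comm ξ η]
    ring
  refine ⟨‖w‖⁻¹ • w, by rw [norm_smul, norm_inv, norm_norm, inv_mul_cancel₀ hw0], ?_⟩
  rw [real_inner_smul_left, real_inner_smul_left, mul_mul_mul_comm, hwξη]
  field_simp

theorem forall_unit_add_mul_nonneg_iff {ξ η : V} {c d : ℝ} (hd : |d| ≤ d + 2 * c)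
    (hξη : 0 ≤ ⟪ξ, η⟫) :
    (∀ v : V, ‖v‖ = 1 → 0 ≤ c * ⟪ξ, η⟫ + d * (⟪v, ξ⟫ * ⟪v, η⟫)) ↔
      |d| * (‖ξ‖ * ‖η‖) ≤ (d + 2 * c) * ⟪ξ, η⟫ := by
  constructor
  · intro h
    obtain ⟨ε, hε, hεd⟩ : ∃ ε : ℝ, ε ^ 2 = 1 ∧ |d| = -(ε * d) := by
      rcases abs_cases d with hd | hd
      · exact ⟨-1, by norm_num, by linarith⟩
      · exact ⟨1, by norm_num, by linarith⟩
    by_cases hpos : 0 < ‖ξ‖ * ‖η‖ * (‖ξ‖ * ‖η‖ + ε * ⟪ξ, η⟫)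
    · obtain ⟨v, hv, hvξη⟩ := exists_unit_two_mul_inner_mul_inner_eq hε hpos
      rw [hεd]
      linear_combination 2 * h v hv + d * hvξη
    · have hle : ‖ξ‖ * ‖η‖ ≤ ⟪ξ, η⟫ := by
        have hε_abs : |ε| = 1 := by rwa [← sq_eq_sq₀ (abs_nonneg ε) zero_le_one, sq_abs, one_pow]
        rcases (mul_nonneg (norm_nonneg ξ) (norm_nonneg η)).eq_or_lt with h0 | h0
        · rwa [← h0]
        · have hneg := nonpos_of_mul_nonpos_right (not_lt.1 hpos) h0
          calc ‖ξ‖ * ‖η‖ ≤ -(ε * ⟪ξ, η⟫) := by linarith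
            _ ≤ |ε * ⟪ξ, η⟫| := neg_le_abs _
            _ = ⟪ξ, η⟫ := by rw [abs_mul, hε_abs, one_mul, abs_of_nonneg hξη]
      exact mul_le_mul hd hle (by positivity) ((abs_nonneg d).trans hd)
  · intro h v hv
    have hrefl := abs_two_mul_inner_mul_inner_sub_le v ξ η
    rw [hv, one_pow, one_mul, one_mul] at hrefl
    have hd_mul : |d * (2 * (⟪v, ξ⟫ * ⟪v, η⟫) - ⟪ξ, η⟫)| ≤ |d| * (‖ξ‖ * ‖η‖) := by
      rw [abs_mul]; gcongr
    linarith [neg_abs_le (d * (2 * (⟪v, ξ⟫ * ⟪v, η⟫) - ⟪ξ, η⟫))]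

end InnerProduct

section SymmetricOperator

open Module.End

variable {V : Type*} [NormedAddCommGroup V] [InnerProductSpace ℝ V]

section LinearMap

variable {T : V →ₗ[ℝ] V} {μ ν : ℝ}

theorem norm_map_sq_add_mul_norm_sq_le [FiniteDimensional ℝ V] (hT : T.IsSymmetric)
    (hspec : ∀ t, HasEigenvalue T t → t ∈ Icc μ ν) (x : V) :
    ‖T x‖ ^ 2 + μ * ν * ‖x‖ ^ 2 ≤ (μ + ν) * ⟪x, T x⟫ := by
  let b := hT.eigenvectorBasis rfl
  have hcoord (i) : ⟪b i, T x⟫ = hT.eigenvalues rfl i * ⟪b i, x⟫ := by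
    rw [← hT (b i) x, hT.apply_eigenvectorBasis, real_inner_smul_left]
    rfl
  have hinner : ⟪x, T x⟫ = ∑ i, ⟪b i, x⟫ * ⟪b i, T x⟫ := by
    rw [← b.sum_inner_mul_inner]
    exact Finset.sum_congr rfl fun i _ => by rw [real_inner_comm x]
  rw [hinner, ← b.sum_sq_norm_inner_right x, ← b.sum_sq_norm_inner_right (T x), Finset.mul_sum,
    Finset.mul_sum, ← Finset.sum_add_distrib]
  refine Finset.sum_le_sum fun i _ => ?_
  obtain ⟨hμi, hiν⟩ := hspec _ (hT.hasEigenvalue_eigenvalues rfl i)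
  simp only [hcoord, Real.norm_eq_abs, sq_abs, RCLike.ofReal_real_eq_id, id] at hμi hiν ⊢
  linear_combination mul_nonneg (mul_nonneg (sub_nonneg.2 hμi) (sub_nonneg.2 hiν))
    (sq_nonneg ⟪b i, x⟫)

theorem two_mul_sqrt_mul_norm_mul_norm_map_le [FiniteDimensional ℝ V] (hT : T.IsSymmetric)
    (hspec : ∀ t, HasEigenvalue T t → t ∈ Icc μ ν) (hμν : 0 ≤ μ * ν) (x : V) :
    2 * √(μ * ν) * (‖x‖ * ‖T x‖) ≤ (μ + ν) * ⟪x, T x⟫ := by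
  linear_combination sq_nonneg (√(μ * ν) * ‖x‖ - ‖T x‖) + ‖x‖ ^ 2 * Real.sq_sqrt hμν +
    norm_map_sq_add_mul_norm_sq_le hT hspec x

theorem exists_norm_eq_one_of_hasEigenvalue (h : HasEigenvalue T μ) :
    ∃ e, ‖e‖ = 1 ∧ T e = μ • e := by
  obtain ⟨e, he⟩ := h.exists_hasEigenvector
  refine ⟨‖e‖⁻¹ • e, ?_, by rw [map_smul, he.apply_eq_smul, smul_comm]⟩
  rw [norm_smul, norm_inv, norm_norm, inv_mul_cancel₀ (norm_ne_zero_iff.2 he.2)]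

theorem antieigenvector_identities {e f : V} (he : ‖e‖ = 1) (hf : ‖f‖ = 1)
    (hef : ⟪e, f⟫ = 0) (hTe : T e = μ • e) (hTf : T f = ν • f) (hμ : 0 ≤ μ) (hν : 0 ≤ ν) :
    ‖√ν • e + √μ • f‖ ^ 2 = μ + ν ∧
      ‖T (√ν • e + √μ • f)‖ = √(μ * ν) * ‖√ν • e + √μ • f‖ ∧
      ⟪√ν • e + √μ • f, T (√ν • e + √μ • f)⟫ = 2 * (μ * ν) := by
  have hinner (a b c d : ℝ) : ⟪a • e + b • f, c • e + d • f⟫ = a * c + b * d := by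
    simp only [inner_add_left, inner_add_right, real_inner_smul_left, real_inner_smul_right,
      real_inner_self_eq_norm_sq, he, hf, hef, real_inner_comm e f]
    ring
  have hTx : T (√ν • e + √μ • f) = (√ν * μ) • e + (√μ * ν) • f := by
    simp only [map_add, map_smul, hTe, hTf, smul_smul]
  have hx2 : ‖√ν • e + √μ • f‖ ^ 2 = μ + ν := by
    rw [← real_inner_self_eq_norm_sq, hinner, Real.mul_self_sqrt hν, Real.mul_self_sqrt hμ,
      add_comm]
  refine ⟨hx2, ?_, ?_⟩
  · rw [← sq_eq_sq₀ (norm_nonneg _) (by positivity), mul_pow, hx2, Real.sq_sqrt (by positivity),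
      ← real_inner_self_eq_norm_sq, hTx, hinner]
    linear_combination μ ^ 2 * Real.mul_self_sqrt hν + ν ^ 2 * Real.mul_self_sqrt hμ
  · rw [hTx, hinner]
    linear_combination μ * Real.mul_self_sqrt hν + ν * Real.mul_self_sqrt hμ

/-- Equality in the Kantorovich inequality is attained at an antieigenvector, the vector most turned
by `T`. -/
theorem exists_two_mul_sqrt_mul_norm_mul_norm_map_eq (hT : T.IsSymmetric)
    (hμ : HasEigenvalue T μ) (hν : HasEigenvalue T ν) (hμ0 : 0 < μ) (hν0 : 0 < ν) :
    ∃ x, 0 < ‖x‖ * ‖T x‖ ∧ (μ + ν) * ⟪x, T x⟫ = 2 * √(μ * ν) * (‖x‖ * ‖T x‖) := by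
  obtain ⟨e, he, hTe⟩ := exists_norm_eq_one_of_hasEigenvalue hμ
  rcases eq_or_ne μ ν with rfl | hne
  · have hnorm : ‖T e‖ = μ := by rw [hTe, norm_smul, he, mul_one, Real.norm_of_nonneg hμ0.le]
    refine ⟨e, by rwa [he, hnorm, one_mul], ?_⟩
    rw [hnorm, he, hTe, real_inner_smul_right, real_inner_self_eq_norm_sq, he,
      Real.sqrt_mul_self hμ0.le]
    ring
  obtain ⟨f, hf, hTf⟩ := exists_norm_eq_one_of_hasEigenvalue hν
  have hef : ⟪e, f⟫ = 0 := by
    have := hT e f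
    rw [hTe, hTf, real_inner_smul_left, real_inner_smul_right] at this
    exact (mul_eq_mul_right_iff.1 this).resolve_left hne
  obtain ⟨hx2, hTx, hxTx⟩ :=
    antieigenvector_identities he hf hef hTe hTf hμ0.le hν0.le
  have hx : 0 < ‖√ν • e + √μ • f‖ := by
    refine (norm_nonneg _).lt_of_ne' fun h0 => ?_
    rw [h0] at hx2
    linarith
  refine ⟨√ν • e + √μ • f, by rw [hTx]; positivity, ?_⟩
  rw [hTx, hxTx]
  linear_combination -2 * (μ * ν) * hx2 -
    2 * ‖√ν • e + √μ • f‖ ^ 2 * Real.sq_sqrt (mul_pos hμ0 hν0).le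

theorem forall_mul_norm_mul_norm_map_le_iff [FiniteDimensional ℝ V] (hT : T.IsSymmetric)
    (hμ : IsLeast {t | HasEigenvalue T t} μ) (hν : IsGreatest {t | HasEigenvalue T t} ν)
    (hμ0 : 0 < μ) {k c : ℝ} (hc : 0 ≤ c) :
    (∀ x, k * (‖x‖ * ‖T x‖) ≤ c * ⟪x, T x⟫) ↔ k * (μ + ν) ≤ c * (2 * √(μ * ν)) := by
  have hν0 : 0 < ν := hμ0.trans_le (hμ.2 hν.1)
  constructor
  · intro h
    obtain ⟨x, hx, heq⟩ := exists_two_mul_sqrt_mul_norm_mul_norm_map_eq hT hμ.1 hν.1 hμ0 hν0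
    refine le_of_mul_le_mul_right ?_ hx
    linear_combination (μ + ν) * h x + c * heq
  · intro h x
    refine le_of_mul_le_mul_right ?_ (add_pos hμ0 hν0)
    have hKantorovich := two_mul_sqrt_mul_norm_mul_norm_map_le hT
      (fun t ht => ⟨hμ.2 ht, hν.2 ht⟩) (mul_pos hμ0 hν0).le x
    calc k * (‖x‖ * ‖T x‖) * (μ + ν) = k * (μ + ν) * (‖x‖ * ‖T x‖) := by ring
      _ ≤ c * (2 * √(μ * ν)) * (‖x‖ * ‖T x‖) := by gcongr
      _ = c * (2 * √(μ * ν) * (‖x‖ * ‖T x‖)) := by ring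
      _ ≤ c * ((μ + ν) * ⟪x, T x⟫) := by gcongr
      _ = c * ⟪x, T x⟫ * (μ + ν) := by ring

end LinearMap

theorem RegularWeight.forall_forall_energyForm_nonneg_iff [FiniteDimensional ℝ V] {φ : ℝ → ℝ}
    (h : RegularWeight φ) {T : V →L[ℝ] V} (hT : T.toLinearMap.IsSymmetric) {μ ν : ℝ}
    (hμ : IsLeast {t | HasEigenvalue T.toLinearMap t} μ)
    (hν : IsGreatest {t | HasEigenvalue T.toLinearMap t} ν) (hμ0 : 0 < μ) :
    (∀ v, v ≠ 0 → ∀ ξ, 0 ≤ energyForm φ T v ξ) ↔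
      LambdaInftySq φ * (μ + ν) ^ 2 ≤ 4 * (μ * ν) := by
  have hν0 : 0 < ν := hμ0.trans_le (hμ.2 hν.1)
  have hinner (ξ : V) : 0 ≤ ⟪ξ, T ξ⟫ := by
    refine nonneg_of_mul_nonneg_right ?_ (add_pos hμ0 hν0)
    exact le_trans (by positivity) (two_mul_sqrt_mul_norm_mul_norm_map_le hT
      (fun t ht => ⟨hμ.2 ht, hν.2 ht⟩) (mul_pos hμ0 hν0).le ξ)
  have hR : (2 * √(μ * ν)) ^ 2 = 4 * (μ * ν) := by
    rw [mul_pow, Real.sq_sqrt (by positivity)]; norm_num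
  rw [← hR, h.LambdaInftySq_mul_sq_le_iff (by positivity) (by positivity)]
  calc (∀ v, v ≠ 0 → ∀ ξ, 0 ≤ energyForm φ T v ξ)
      ↔ ∀ ξ v, v ≠ 0 → 0 ≤ energyForm φ T v ξ :=
        ⟨fun H ξ v hv => H v hv ξ, fun H v hv ξ => H ξ v hv⟩
    _ ↔ ∀ ξ s, 0 < s → |s * deriv φ s| * (‖ξ‖ * ‖T ξ‖) ≤
          (s * deriv φ s + 2 * φ s) * ⟪ξ, T ξ⟫ := forall_congr' fun ξ =>
        (h.forall_energyForm_nonneg_iff T ξ).trans <| forall₂_congr fun s hs =>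
          forall_unit_add_mul_nonneg_iff (h.abs_mul_deriv_le hs) (hinner ξ)
    _ ↔ ∀ s, 0 < s → ∀ ξ, |s * deriv φ s| * (‖ξ‖ * ‖T ξ‖) ≤
          (s * deriv φ s + 2 * φ s) * ⟪ξ, T ξ⟫ :=
        ⟨fun H s hs ξ => H ξ s hs, fun H ξ s hs => H s hs ξ⟩
    _ ↔ _ := forall₂_congr fun s hs =>
        forall_mul_norm_mul_norm_map_le_iff hT hμ hν hμ0 (h.mul_deriv_add_two_mul_pos hs).le

end SymmetricOperator

section Localization

variable {E : Type*} [NormedAddCommGroup E] [NormedSpace ℝ E] [FiniteDimensional ℝ E]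

theorem exists_contDiff_bump_eq_one_iff {K U : Set E} (hK : IsCompact K) (hU : IsOpen U)
    (hKU : K ⊆ U) :
    ∃ ρ : E → ℝ, ContDiff ℝ 1 ρ ∧ HasCompactSupport ρ ∧ tsupport ρ ⊆ U ∧
      (∀ x, ρ x ∈ Icc 0 1) ∧ ∀ x, ρ x = 1 ↔ x ∈ K := by
  have : ProperSpace E := FiniteDimensional.proper_real E
  obtain ⟨L, hL, hKL, hLU⟩ := exists_compact_between hK hU hKU
  obtain ⟨ρ, hρ, hρ01, hρ0, hρ1⟩ := exists_contMDiff_zero_iff_one_iff_of_isClosed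
    (modelWithCornersSelf ℝ E) (n := 1) isOpen_interior.isClosed_compl hK.isClosed
    (disjoint_compl_left_iff_subset.2 hKL)
  have hsupp : tsupport ρ ⊆ L := closure_minimal
    (fun x hx => interior_subset (not_not.1 (mt (hρ0 x).1 hx))) hL.isClosed
  exact ⟨ρ, hρ.contDiff, hL.of_isClosed_subset (isClosed_tsupport _) hsupp, hsupp.trans hLU,
    fun x => hρ01 (mem_range_self x), fun x => (hρ1 x).symm⟩

variable [MeasurableSpace E] [BorelSpace E] {μ : Measure E} {U : Set E} {f : E → ℝ}

theorem setIntegral_nonneg_of_forall_sq_mul_nonneg (hU : IsOpen U)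
    (hf : LocallyIntegrableOn f U μ)
    (h : ∀ η : E → ℝ, ContDiff ℝ 1 η → HasCompactSupport η → tsupport η ⊆ U →
      0 ≤ ∫ x in U, η x ^ 2 * f x ∂μ) {K : Set E} (hK : IsCompact K) (hKU : K ⊆ U) :
    0 ≤ ∫ x in K, f x ∂μ := by
  obtain ⟨ρ, hρ, hρc, hρU, hρ01, hρ1⟩ := exists_contDiff_bump_eq_one_iff hK hU hKU
  set L := tsupport ρ
  have hKL : K ⊆ L := fun x hx => subset_tsupport ρ (by simp [(hρ1 x).2 hx])
  have hfL : IntegrableOn f L μ := hf.integrableOn_compact_subset hρU hρc.isCompact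
  have hpos (n : ℕ) : 0 ≤ ∫ x in L, (ρ x ^ (n + 1)) ^ 2 * f x ∂μ := by
    have hsupp : tsupport (fun x => ρ x ^ (n + 1)) ⊆ L :=
      closure_mono fun x hx h0 => hx (by simp [h0])
    rw [← setIntegral_eq_of_subset_of_forall_sdiff_eq_zero hU.measurableSet hρU fun x hx => by
      simp [image_eq_zero_of_notMem_tsupport hx.2]]
    exact h _ (hρ.pow _) (hρc.of_isClosed_subset (isClosed_tsupport _) hsupp) (hsupp.trans hρU)
  have hlim : Tendsto (fun n : ℕ => ∫ x in L, (ρ x ^ (n + 1)) ^ 2 * f x ∂μ) atTop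
      (𝓝 (∫ x in L, K.indicator f x ∂μ)) := by
    refine tendsto_integral_of_dominated_convergence (fun x => ‖f x‖) (fun n => ?_) hfL.norm
      (fun n => ae_of_all _ fun x => ?_) (ae_of_all _ fun x => ?_)
    · exact ((hρ.continuous.pow _).pow 2).aestronglyMeasurable.mul hfL.aestronglyMeasurable
    · rw [norm_mul, Real.norm_of_nonneg (sq_nonneg _)]
      exact mul_le_of_le_one_left (norm_nonneg _)
        (pow_le_one₀ (pow_nonneg (hρ01 x).1 _) (pow_le_one₀ (hρ01 x).1 (hρ01 x).2))
    · by_cases hx : x ∈ K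
      · simp [hx, (hρ1 x).2 hx]
      · have hlt : ρ x < 1 := (hρ01 x).2.lt_of_ne (mt (hρ1 x).1 hx)
        have hpow : Tendsto (fun n => ρ x ^ (n + 1)) atTop (𝓝 0) :=
          (tendsto_add_atTop_iff_nat 1).2 (tendsto_pow_atTop_nhds_zero_of_lt_one (hρ01 x).1 hlt)
        simpa [hx] using (hpow.pow 2).mul_const (f x)
  have hnonneg := ge_of_tendsto' hlim hpos
  rwa [setIntegral_indicator hK.measurableSet, inter_eq_right.2 hKL] at hnonneg

theorem ae_nonneg_of_forall_setIntegral_isCompact_nonneg [IsLocallyFiniteMeasure μ]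
    (hU : IsOpen U) (hf : LocallyIntegrableOn f U μ)
    (h : ∀ K, IsCompact K → K ⊆ U → 0 ≤ ∫ x in K, f x ∂μ) :
    ∀ᵐ x ∂μ.restrict U, 0 ≤ f x := by
  have : ProperSpace E := FiniteDimensional.proper_real E
  have hfm : AEStronglyMeasurable f (μ.restrict U) := hf.aestronglyMeasurable
  set g := hfm.mk f
  have hneg : MeasurableSet (U ∩ {x | g x < 0}) := hU.measurableSet.inter
    (measurableSet_lt hfm.stronglyMeasurable_mk.measurable measurable_const)
  suffices hnull : μ (U ∩ {x | g x < 0}) = 0 by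
    filter_upwards [hfm.ae_eq_mk, ae_restrict_mem hU.measurableSet,
      ae_restrict_of_ae (measure_eq_zero_iff_ae_notMem.1 hnull)] with x hfg hxU hx
    exact hfg ▸ not_lt.1 fun hlt => hx ⟨hxU, hlt⟩
  by_contra hne
  obtain ⟨K, hKsub, hK, hKpos⟩ := hneg.exists_lt_isCompact (pos_iff_ne_zero.2 hne)
  have hKU : K ⊆ U := hKsub.trans inter_subset_left
  have hfg : f =ᵐ[μ.restrict K] g := ae_restrict_of_ae_restrict_of_subset hKU hfm.ae_eq_mk
  have hgK : IntegrableOn g K μ := (hf.integrableOn_compact_subset hKU hK).congr hfg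
  have hpos : 0 < ∫ x in K, (-g) x ∂μ := by
    rw [setIntegral_pos_iff_support_of_nonneg_ae
      (ae_restrict_of_forall_mem hK.measurableSet fun x hx => by simpa using (hKsub hx).2.le)
      hgK.neg, inter_eq_right.2 fun x hx => by simpa using (hKsub hx).2.ne]
    exact hKpos
  have := h K hK hKU
  rw [integral_congr_ae hfg] at this
  rw [integral_neg'] at hpos
  linarith

theorem ae_nonneg_of_forall_sq_mul_nonneg [IsLocallyFiniteMeasure μ] (hU : IsOpen U)
    (hf : LocallyIntegrableOn f U μ)
    (h : ∀ η : E → ℝ, ContDiff ℝ 1 η → HasCompactSupport η → tsupport η ⊆ U →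
      0 ≤ ∫ x in U, η x ^ 2 * f x ∂μ) :
    ∀ᵐ x ∂μ.restrict U, 0 ≤ f x :=
  ae_nonneg_of_forall_setIntegral_isCompact_nonneg hU hf fun _ hK hKU =>
    setIntegral_nonneg_of_forall_sq_mul_nonneg hU hf h hK hKU

end Localization

section Dissipativity

variable {V W : Type*} {I : Set ℝ} {φ : ℝ → ℝ}

/-- The class `C¹_c(I; V)` of test maps, extended by zero to `ℝ`. -/
def IsTestMap [NormedAddCommGroup V] [NormedSpace ℝ V] (I : Set ℝ) (u : ℝ → V) : Prop :=
  ContDiff ℝ 1 u ∧ HasCompactSupport u ∧ tsupport u ⊆ I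

namespace IsTestMap

variable [NormedAddCommGroup V] [NormedSpace ℝ V] [NormedAddCommGroup W] [NormedSpace ℝ W]
  {u w : ℝ → V}

theorem of_support_subset (hu : IsTestMap I u) {w : ℝ → W} (hw : ContDiff ℝ 1 w)
    (h : Function.support w ⊆ Function.support u) : IsTestMap I w :=
  ⟨hw, hu.2.1.mono h, (closure_mono h).trans hu.2.2⟩

theorem add (hu : IsTestMap I u) (hw : IsTestMap I w) : IsTestMap I (u + w) :=
  ⟨hu.1.add hw.1, hu.2.1.add hw.2.1, (tsupport_add u w).trans (union_subset hu.2.2 hw.2.2)⟩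

theorem continuous_deriv (hu : IsTestMap I u) : Continuous (deriv u) :=
  hu.1.continuous_deriv le_rfl

end IsTestMap

theorem locallyIntegrableOn_clm_apply [NormedAddCommGroup V] [NormedSpace ℝ V]
    [NormedAddCommGroup W] [NormedSpace ℝ W] {T : ℝ → V →L[ℝ] W} (hT : LocallyIntegrableOn T I)
    (hI : IsOpen I) {g : ℝ → V} (hg : Continuous g) :
    LocallyIntegrableOn (fun x => T x (g x)) I := by
  rw [locallyIntegrableOn_iff hI.isLocallyClosed] at hT ⊢
  intro K hKI hK
  obtain ⟨C, hC⟩ := hK.exists_bound_of_continuousOn hg.continuousOn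
  exact (ContinuousLinearMap.apply ℝ W : V →L[ℝ] _).integrable_of_bilin_of_bdd_left C
    hg.aestronglyMeasurable (ae_restrict_of_forall_mem hK.measurableSet hC) (hT K hKI hK)

variable [NormedAddCommGroup V] [InnerProductSpace ℝ V] {T : ℝ → V →L[ℝ] V} {u : ℝ → V}

/-- `L^Φ`-dissipativity of the operator `u ↦ (T u')'` on `I`, for maps with values in a real inner
product space. -/
def IsDissipative (φ : ℝ → ℝ) (I : Set ℝ) (T : ℝ → V →L[ℝ] V) : Prop :=
  ∀ u : ℝ → V, IsTestMap I u → IsTestMap I (radialMap φ ∘ u) →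
    0 ≤ ∫ x in I, ⟪deriv (radialMap φ ∘ u) x, T x (deriv u x)⟫

theorem integrableOn_inner_of_tsupport_subset {𝕜 : Type*} [RCLike 𝕜] [NormedAddCommGroup W]
    [InnerProductSpace 𝕜 W] {f h : ℝ → W} (hf : Continuous f) (hfc : HasCompactSupport f)
    (hfI : tsupport f ⊆ I) (hI : IsOpen I) (hh : LocallyIntegrableOn h I) :
    IntegrableOn (fun x => inner 𝕜 (f x) (h x)) I := by
  obtain ⟨C, hC⟩ := hfc.exists_bound_of_continuous hf
  have hhf : IntegrableOn h (tsupport f) := hh.integrableOn_compact_subset hfI hfc.isCompact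
  refine IntegrableOn.of_forall_sdiff_eq_zero (s := tsupport f) ?_ hI.measurableSet fun x hx => by
    rw [image_eq_zero_of_notMem_tsupport hx.2, inner_zero_left]
  refine (hhf.norm.const_mul C).mono' (hf.aestronglyMeasurable.inner hhf.1)
    (ae_of_all _ fun x => ?_)
  exact (norm_inner_le_norm _ _).trans (by gcongr; exact hC x)

theorem IsTestMap.integrableOn_inner_deriv {w : ℝ → V} (hw : IsTestMap I w) (hu : IsTestMap I u)
    (hI : IsOpen I) (hT : LocallyIntegrableOn T I) :
    IntegrableOn (fun x => ⟪deriv w x, T x (deriv u x)⟫) I :=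
  integrableOn_inner_of_tsupport_subset hw.continuous_deriv hw.2.1.deriv
    (tsupport_deriv_subset.trans hw.2.2) hI
    (locallyIntegrableOn_clm_apply hT hI hu.continuous_deriv)

theorem RegularWeight.deriv_radialMap_comp (h : RegularWeight φ) {x : ℝ} {ξ : V}
    (hu : HasDerivAt u ξ x) (hne : u x ≠ 0) :
    deriv (radialMap φ ∘ u) x = fderiv ℝ (radialMap φ) (u x) ξ :=
  (((h.contDiffAt_radialMap hne).differentiableAt one_ne_zero).hasFDerivAt.comp_hasDerivAt x
    hu).deriv

theorem RegularWeight.inner_deriv_radialMap_comp_nonneg (h : RegularWeight φ) {T : V →L[ℝ] V}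
    (hT : ∀ v, v ≠ 0 → ∀ ξ, 0 ≤ energyForm φ T v ξ) (hu : ContDiff ℝ 1 u)
    (hw : ContDiff ℝ 1 (radialMap φ ∘ u)) (x : ℝ) :
    0 ≤ ⟪deriv (radialMap φ ∘ u) x, T (deriv u x)⟫ := by
  have hderiv (y : ℝ) : HasDerivAt u (deriv u y) y :=
    (hu.differentiable one_ne_zero y).hasDerivAt
  by_cases hx : deriv u x = 0
  · rw [hx, map_zero, inner_zero_right]
  -- If `u x = 0` then `u ≠ 0` near `x` off `x`, so the pointwise bound passes to the limit.
  have hcont : Continuous fun y => ⟪deriv (radialMap φ ∘ u) y, T (deriv u y)⟫ :=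
    (hw.continuous_deriv le_rfl).inner (T.continuous.comp (hu.continuous_deriv le_rfl))
  refine ge_of_tendsto (hcont.continuousAt.tendsto.mono_left
    (nhdsWithin_le_nhds (s := {x}ᶜ))) ?_
  filter_upwards [(hderiv x).eventually_ne (c := 0) hx] with y hy
  rw [h.deriv_radialMap_comp (hderiv y) hy]
  exact hT _ hy _

theorem RegularWeight.isDissipative_of_ae (h : RegularWeight φ)
    (hT : ∀ᵐ x ∂volume.restrict I, ∀ v, v ≠ 0 → ∀ ξ, 0 ≤ energyForm φ (T x) v ξ) :
    IsDissipative φ I T := fun _ hu hw =>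
  integral_nonneg_of_ae (hT.mono fun x hx => h.inner_deriv_radialMap_comp_nonneg hx hu.1 hw.1 x)

end Dissipativity

section Plateau

variable {φ : ℝ → ℝ}

theorem contDiff_comp_sq {θ : ℝ → ℝ} {C : NNReal} (hlip : LipschitzWith C θ)
    (hθ : ContDiffOn ℝ 1 θ (Ioi 0)) : ContDiff ℝ 1 fun y => θ (y ^ 2) := by
  have hbound (y : ℝ) : ‖deriv θ (y ^ 2) * (2 * y)‖ ≤ C * |2 * y| := by
    rw [norm_mul, Real.norm_eq_abs (2 * y)]
    gcongr
    exact norm_deriv_le_of_lipschitz hlip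
  have hcont_zero : ContinuousAt (fun y => deriv θ (y ^ 2) * (2 * y)) 0 := by
    have hlim : Tendsto (fun y : ℝ => C * |2 * y|) (𝓝 0) (𝓝 0) :=
      (by fun_prop : Continuous fun y : ℝ => C * |2 * y|).tendsto' 0 0 (by simp)
    simpa [ContinuousAt] using squeeze_zero_norm hbound hlim
  have hderiv (y : ℝ) : HasDerivAt (fun y => θ (y ^ 2)) (deriv θ (y ^ 2) * (2 * y)) y := by
    refine hasDerivAt_of_hasDerivAt_of_ne' (x := 0) (g := fun y => deriv θ (y ^ 2) * (2 * y))
      (fun y hy => ?_) (hlip.continuous.comp (continuous_pow 2)).continuousAt hcont_zero y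
    have hθy : HasDerivAt θ (deriv θ (y ^ 2)) (y ^ 2) := ((hθ.differentiableOn
      one_ne_zero).differentiableAt (Ioi_mem_nhds (sq_pos_of_ne_zero hy))).hasDerivAt
    simpa using HasDerivAt.comp (h := fun y : ℝ => y ^ 2) y hθy (hasDerivAt_pow 2 y)
  rw [contDiff_one_iff_deriv]
  refine ⟨fun y => (hderiv y).differentiableAt, ?_⟩
  rw [funext fun y => (hderiv y).deriv, continuous_iff_continuousAt]
  intro y
  obtain rfl | hy := eq_or_ne y 0
  · exact hcont_zero
  · have hdθ : ContinuousAt (deriv θ) (y ^ 2) :=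
      (hθ.continuousOn_deriv_of_isOpen isOpen_Ioi le_rfl).continuousAt
        (Ioi_mem_nhds (sq_pos_of_ne_zero hy))
    exact (hdθ.comp (f := fun y : ℝ => y ^ 2) (by fun_prop)).mul (by fun_prop)

namespace RegularWeight

theorem continuousOn_mul_Ici (h : RegularWeight φ) :
    ContinuousOn (fun s => s * φ s) (Ici 0) := by
  intro s hs
  obtain rfl | hs := eq_or_lt_of_le (mem_Ici.1 hs)
  · rw [← continuousWithinAt_Ioi_iff_Ici, ContinuousWithinAt, zero_mul]
    exact h.tendsto_zero
  · exact (h.hasDerivAt_mul hs).continuousAt.continuousWithinAt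

theorem monotoneOn_mul_Ici (h : RegularWeight φ) : MonotoneOn (fun s => s * φ s) (Ici 0) := by
  intro s hs t _ hst
  obtain rfl | hs := eq_or_lt_of_le (mem_Ici.1 hs)
  · obtain rfl | ht := eq_or_lt_of_le hst
    · rfl
    · simpa using (mul_pos ht (h.pos t ht)).le
  · exact h.monotoneOn_mul hs (hs.trans_le hst) hst

theorem exists_orderIso_add_mul (h : RegularWeight φ) :
    ∃ e : ℝ ≃o ℝ, (∀ s, 0 ≤ s → e s = s + s * φ s) ∧ ∀ s t, s ≤ t → t - s ≤ e t - e s := by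
  set F : ℝ → ℝ := fun s => max s 0 * φ (max s 0)
  have hFmono : Monotone F := fun s t hst =>
    h.monotoneOn_mul_Ici (mem_Ici.2 (le_max_right s 0)) (mem_Ici.2 (le_max_right t 0))
      (max_le_max_right 0 hst)
  have hFcont : Continuous F :=
    h.continuousOn_mul_Ici.comp_continuous (by fun_prop) fun s => le_max_right s 0
  have hmono : StrictMono fun s => s + F s := strictMono_id.add_monotone hFmono
  have hcont : Continuous fun s => s + F s := continuous_id.add hFcont
  have hsurj : Function.Surjective fun s => s + F s := by
    refine hcont.surjective
      (tendsto_atTop_mono' _ ?_ tendsto_id) (tendsto_atBot_mono' _ ?_ tendsto_id)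
    · filter_upwards [eventually_ge_atTop 0] with s hs
      simpa [F] using hFmono hs
    · filter_upwards [eventually_le_atBot 0] with s hs
      simpa [F] using hFmono hs
  refine ⟨hmono.orderIsoOfSurjective _ hsurj, fun s hs => ?_, fun s t hst => ?_⟩
  · simp only [StrictMono.coe_orderIsoOfSurjective, F, max_eq_left hs]
  · simp only [StrictMono.coe_orderIsoOfSurjective]
    linarith [hFmono hst]

theorem exists_lipschitzWith_inverse (h : RegularWeight φ) :
    ∃ θ : ℝ → ℝ, LipschitzWith 1 θ ∧ ContDiffOn ℝ 1 θ (Ioi 0) ∧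
      (∀ s, 0 ≤ s → θ (s + s * φ s) = s) ∧ ∀ y, 0 ≤ y → 0 ≤ θ y ∧ θ y + θ y * φ (θ y) = y := by
  obtain ⟨e, he, hexp⟩ := h.exists_orderIso_add_mul
  have he_zero : e.symm 0 = 0 := e.symm_apply_eq.2 (by simp [he 0 le_rfl])
  refine ⟨e.symm, LipschitzWith.of_le_add fun x y => ?_, fun y hy => ?_, fun s hs => ?_,
    fun y hy => ?_⟩
  · obtain hxy | hyx := le_total x y
    · exact (e.symm.monotone hxy).trans (le_add_of_nonneg_right dist_nonneg)
    · have := hexp _ _ (e.symm.monotone hyx)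
      simp only [e.apply_symm_apply] at this
      linarith [Real.dist_eq x y ▸ le_abs_self (x - y)]
  · have hpos : 0 < e.symm y := he_zero ▸ e.symm.strictMono hy
    have heq : e =ᶠ[𝓝 (e.symm y)] fun s => s + s * φ s := by
      filter_upwards [Ioi_mem_nhds hpos] with s hs using he s (mem_Ioi.1 hs).le
    have hderiv := ((hasDerivAt_id' _).fun_add (h.hasDerivAt_mul hpos)).congr_of_eventuallyEq heq
    have hcontDiff : ContDiffAt ℝ 1 e (e.symm y) :=
      (contDiffAt_id.add (contDiffAt_id.mul
        (h.contDiffOn.contDiffAt (Ioi_mem_nhds hpos)))).congr_of_eventuallyEq heq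
    exact (e.toHomeomorph.toOpenPartialHomeomorph.contDiffAt_symm_deriv (a := y)
      (by linarith [h.add_mul_deriv_nonneg hpos]) (mem_univ _) hderiv hcontDiff).contDiffWithinAt
  · rw [← he s hs, e.symm_apply_apply]
  · have hnonneg : 0 ≤ e.symm y := he_zero ▸ e.symm.monotone hy
    exact ⟨hnonneg, he _ hnonneg ▸ e.apply_symm_apply y⟩

/-- With `θ` inverse to `s ↦ s + s φ(s)`, both `γ(y) = θ(c y²)` and `γ φ(γ) = c y² - γ` are `C¹`. -/
theorem exists_contDiff_profile (h : RegularWeight φ) {s : ℝ} (hs : 0 < s) :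
    ∃ γ : ℝ → ℝ, ContDiff ℝ 1 γ ∧ ContDiff ℝ 1 (fun y => γ y * φ (γ y)) ∧
      (∀ y, 0 ≤ γ y) ∧ γ 0 = 0 ∧ γ 1 = s := by
  obtain ⟨θ, hlip, hθ, hleft, hright⟩ := h.exists_lipschitzWith_inverse
  have hc : 0 < s + s * φ s := add_pos hs (mul_pos hs (h.pos s hs))
  set c := √(s + s * φ s)
  have hγ : ContDiff ℝ 1 fun y => θ ((c * y) ^ 2) :=
    (contDiff_comp_sq hlip hθ).comp (contDiff_const.mul contDiff_id)
  refine ⟨fun y => θ ((c * y) ^ 2), hγ, ?_, fun y => (hright _ (sq_nonneg _)).1, ?_, ?_⟩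
  · have heq (y : ℝ) : θ ((c * y) ^ 2) * φ (θ ((c * y) ^ 2)) = (c * y) ^ 2 - θ ((c * y) ^ 2) :=
      eq_sub_of_add_eq' (hright _ (sq_nonneg _)).2
    simp only [heq]
    exact ((contDiff_const.mul contDiff_id).pow 2).sub hγ
  · simpa using hleft 0 le_rfl
  · simp only [mul_one, c, Real.sq_sqrt hc.le, hleft s hs.le]

theorem exists_plateau {V : Type*} [NormedAddCommGroup V] [InnerProductSpace ℝ V]
    (h : RegularWeight φ) {v : V} (hv : v ≠ 0) {K I : Set ℝ} (hK : IsCompact K) (hI : IsOpen I)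
    (hKI : K ⊆ I) :
    ∃ u : ℝ → V, IsTestMap I u ∧ IsTestMap I (radialMap φ ∘ u) ∧ ∀ x ∈ K, u =ᶠ[𝓝 x] fun _ => v := by
  have hs : 0 < ‖v‖ := norm_pos_iff.2 hv
  obtain ⟨L, hL, hKL, hLI⟩ := exists_compact_between hK hI hKI
  obtain ⟨ρ, hρ, hρc, hρI, -, hρ1⟩ := exists_contDiff_bump_eq_one_iff hL hI hLI
  obtain ⟨γ, hγ, hγφ, hγ0, hγ_zero, hγ_one⟩ := h.exists_contDiff_profile hs
  have hρtest : IsTestMap I ρ := ⟨hρ, hρc, hρI⟩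
  have hnorm (x : ℝ) : ‖(γ (ρ x) / ‖v‖) • v‖ = γ (ρ x) := by
    rw [norm_smul, Real.norm_of_nonneg (div_nonneg (hγ0 _) hs.le), div_mul_cancel₀ _ hs.ne']
  refine ⟨fun x => (γ (ρ x) / ‖v‖) • v, hρtest.of_support_subset ?_ ?_,
    hρtest.of_support_subset ?_ ?_, fun x hx => ?_⟩
  · exact ((hγ.comp hρ).div_const _).smul contDiff_const
  · exact fun x hx h0 => hx (by simp [h0, hγ_zero])
  · have heq : (radialMap φ ∘ fun x => (γ (ρ x) / ‖v‖) • v) = fun x =>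
        (γ (ρ x) * φ (γ (ρ x)) / ‖v‖) • v := by
      ext1 x
      simp only [Function.comp_apply, radialMap, hnorm, smul_smul]
      ring_nf
    rw [heq]
    exact ((hγφ.comp hρ).div_const _).smul contDiff_const
  · exact fun x hx h0 => hx (by simp [h0, hγ_zero])
  · filter_upwards [mem_interior_iff_mem_nhds.1 (hKL hx)] with y hy
    rw [(hρ1 y).2 hy, hγ_one, div_self hs.ne', one_smul]

end RegularWeight

end Plateau

section Perturbation

variable {V : Type*} [NormedAddCommGroup V] [InnerProductSpace ℝ V] {φ : ℝ → ℝ} {I : Set ℝ}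
  {u : ℝ → V} {v ξ : V} {β : ℝ → ℝ}

theorem IsTestMap.radialMap_comp (hu : IsTestMap I u) (hw : ContDiff ℝ 1 (radialMap φ ∘ u)) :
    IsTestMap I (radialMap φ ∘ u) :=
  hu.of_support_subset hw fun x hx h0 => hx (by simp [h0])

theorem eventuallyEq_add_smul (hloc : ∀ x ∈ tsupport β, u =ᶠ[𝓝 x] fun _ => v) (x : ℝ) :
    x ∈ tsupport β ∧ (u + fun y => β y • ξ) =ᶠ[𝓝 x] (fun y => v + β y • ξ) ∨
      β =ᶠ[𝓝 x] 0 ∧ (u + fun y => β y • ξ) =ᶠ[𝓝 x] u := by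
  by_cases hx : x ∈ tsupport β
  · exact .inl ⟨hx, (hloc x hx).add .rfl⟩
  · have hβ := notMem_tsupport_iff_eventuallyEq.1 hx
    exact .inr ⟨hβ, hβ.mono fun y hy => by simp [hy]⟩

theorem RegularWeight.contDiff_radialMap_comp_add_smul (h : RegularWeight φ)
    (hw : ContDiff ℝ 1 (radialMap φ ∘ u)) (hβ : ContDiff ℝ 1 β)
    (hloc : ∀ x ∈ tsupport β, u =ᶠ[𝓝 x] fun _ => v) (hne : ∀ x, v + β x • ξ ≠ 0) :
    ContDiff ℝ 1 (radialMap φ ∘ (u + fun x => β x • ξ)) := by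
  rw [contDiff_iff_contDiffAt]
  intro x
  obtain ⟨-, hux⟩ | ⟨-, hux⟩ := eventuallyEq_add_smul (ξ := ξ) hloc x
  · have hline : ContDiffAt ℝ 1 (fun y => v + β y • ξ) x :=
      (contDiff_const.add (hβ.smul contDiff_const)).contDiffAt
    exact ((h.contDiffAt_radialMap (hne x)).comp x hline).congr_of_eventuallyEq
      (hux.fun_comp (radialMap φ))
  · exact hw.contDiffAt.congr_of_eventuallyEq (hux.fun_comp (radialMap φ))

theorem RegularWeight.inner_deriv_radialMap_comp_add_smul (h : RegularWeight φ) (T : V →L[ℝ] V)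
    (hβ : ContDiff ℝ 1 β) (hloc : ∀ x ∈ tsupport β, u =ᶠ[𝓝 x] fun _ => v)
    (hne : ∀ x, v + β x • ξ ≠ 0) (x : ℝ) :
    ⟪deriv (radialMap φ ∘ (u + fun y => β y • ξ)) x, T (deriv (u + fun y => β y • ξ) x)⟫ =
      ⟪deriv (radialMap φ ∘ u) x, T (deriv u x)⟫ +
        deriv β x ^ 2 * energyForm φ T (v + β x • ξ) ξ := by
  obtain ⟨hx, hux⟩ | ⟨hβx, hux⟩ := eventuallyEq_add_smul (ξ := ξ) hloc x
  · have hline : HasDerivAt (fun y => v + β y • ξ) (deriv β x • ξ) x :=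
      ((hβ.differentiable one_ne_zero x).hasDerivAt.smul_const ξ).const_add v
    rw [(hux.fun_comp (radialMap φ)).deriv_eq, hux.deriv_eq, (hloc x hx).deriv_eq, deriv_const,
      map_zero, inner_zero_right, zero_add, ← energyForm_smul, energyForm, ← hline.deriv]
    exact congrArg (⟪·, _⟫) (hline.deriv ▸ h.deriv_radialMap_comp hline (hne x))
  · rw [(hux.fun_comp (radialMap φ)).deriv_eq, hux.deriv_eq, hβx.deriv_eq]
    simp

theorem RegularWeight.exists_forall_add_integral_energyForm_nonneg (h : RegularWeight φ)
    {T : ℝ → V →L[ℝ] V} (hI : IsOpen I) (hT : LocallyIntegrableOn T I) (hdiss : IsDissipative φ I T)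
    (hv : v ≠ 0) (ξ : V) {K : Set ℝ} (hK : IsCompact K) (hKI : K ⊆ I) :
    ∃ C : ℝ, ∀ β : ℝ → ℝ, ContDiff ℝ 1 β → tsupport β ⊆ K → (∀ x, v + β x • ξ ≠ 0) →
      0 ≤ C + ∫ x in I, deriv β x ^ 2 * energyForm φ (T x) (v + β x • ξ) ξ := by
  obtain ⟨u, hu, hw, hloc⟩ := h.exists_plateau hv hK hI hKI
  refine ⟨∫ x in I, ⟪deriv (radialMap φ ∘ u) x, T x (deriv u x)⟫, fun β hβ hβK hne => ?_⟩
  have hlocβ : ∀ x ∈ tsupport β, u =ᶠ[𝓝 x] fun _ => v := fun x hx => hloc x (hβK hx)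
  have hβtest : IsTestMap I β :=
    ⟨hβ, hK.of_isClosed_subset (isClosed_tsupport _) hβK, hβK.trans hKI⟩
  have huβ : IsTestMap I (u + fun x => β x • ξ) := hu.add <|
    hβtest.of_support_subset (hβ.smul contDiff_const) (Function.support_smul_subset_left _ _)
  have hwβ := huβ.radialMap_comp (h.contDiff_radialMap_comp_add_smul hw.1 hβ hlocβ hne)
  have hpert (x : ℝ) := h.inner_deriv_radialMap_comp_add_smul (T x) hβ hlocβ hne x
  have hdiff : ∫ x in I, deriv β x ^ 2 * energyForm φ (T x) (v + β x • ξ) ξ =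
      (∫ x in I, ⟪deriv (radialMap φ ∘ (u + fun y => β y • ξ)) x,
        T x (deriv (u + fun y => β y • ξ) x)⟫) -
      ∫ x in I, ⟪deriv (radialMap φ ∘ u) x, T x (deriv u x)⟫ := by
    rw [← integral_sub (hwβ.integrableOn_inner_deriv huβ hI hT)
      (hw.integrableOn_inner_deriv hu hI hT)]
    simp only [hpert, add_sub_cancel_left]
  rw [hdiff, add_sub_cancel]
  exact hdiss _ huβ hwβ

end Perturbation

section Oscillation

open Real

variable {V : Type*} [NormedAddCommGroup V] [NormedSpace ℝ V] {η : ℝ → ℝ} {P : ℝ → V}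
  {N ϑ x δ : ℝ}

/-- A perturbation of amplitude `O(1/N)` whose slope `≈ N cos(N² x + ϑ) η(x)` blows up as `N → ∞`.
The phases `ϑ = 0` and `ϑ = π/2` are used together, so that `cos²` and `sin²` add up to `1`. -/
def oscillation (η : ℝ → ℝ) (N ϑ x : ℝ) : ℝ := N⁻¹ * sin (N ^ 2 * x + ϑ) * η x

/-- The coefficient `N⁻² ∑ (β')² P(β)` of the energy of the oscillations `β` of frequency `N²`,
summed over the phases `0` and `π/2`. -/
def phaseSum (η : ℝ → ℝ) (P : ℝ → V) (N x : ℝ) : V :=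
  (deriv (oscillation η N 0) x / N) ^ 2 • P (oscillation η N 0 x) +
    (deriv (oscillation η N (π / 2)) x / N) ^ 2 • P (oscillation η N (π / 2) x)

theorem contDiff_oscillation (hη : ContDiff ℝ 1 η) (N ϑ : ℝ) :
    ContDiff ℝ 1 (oscillation η N ϑ) := by
  unfold oscillation
  fun_prop

theorem support_oscillation_subset (η : ℝ → ℝ) (N ϑ : ℝ) :
    Function.support (oscillation η N ϑ) ⊆ Function.support η :=
  fun x hx h0 => hx (by simp [oscillation, h0])

theorem deriv_oscillation_div (hη : ContDiff ℝ 1 η) (hN : N ≠ 0) (ϑ x : ℝ) :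
    deriv (oscillation η N ϑ) x / N =
      cos (N ^ 2 * x + ϑ) * η x + sin (N ^ 2 * x + ϑ) * (deriv η x / N ^ 2) := by
  have hphase : HasDerivAt (fun y => N ^ 2 * y + ϑ) (N ^ 2) x := by
    simpa using ((hasDerivAt_id' x).const_mul (N ^ 2)).add_const ϑ
  have hderiv : HasDerivAt (oscillation η N ϑ) _ x :=
    (hphase.sin.const_mul N⁻¹).mul (hη.differentiable one_ne_zero x).hasDerivAt
  rw [hderiv.deriv]
  field_simp

theorem abs_oscillation_le (hN : 0 < N) (ϑ x : ℝ) : |oscillation η N ϑ x| ≤ |η x| / N := by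
  rw [oscillation, abs_mul, abs_mul, abs_of_pos (inv_pos.2 hN), div_eq_inv_mul]
  gcongr
  exact mul_le_of_le_one_right (inv_pos.2 hN).le (abs_sin_le_one _)

theorem abs_deriv_oscillation_div_le (hη : ContDiff ℝ 1 η) (hN : 1 ≤ N) (ϑ x : ℝ) :
    |deriv (oscillation η N ϑ) x / N| ≤ |η x| + |deriv η x| := by
  rw [deriv_oscillation_div hη (one_pos.trans_le hN).ne']
  refine (abs_add_le _ _).trans (add_le_add ?_ ?_)
  · rw [abs_mul]
    exact mul_le_of_le_one_left (abs_nonneg _) (abs_cos_le_one _)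
  · rw [abs_mul, abs_div, abs_of_nonneg (sq_nonneg N)]
    exact (mul_le_of_le_one_left (by positivity) (abs_sin_le_one _)).trans
      (div_le_self (abs_nonneg _) (one_le_pow₀ hN))

theorem sq_deriv_oscillation_div_add_sq (hη : ContDiff ℝ 1 η) (hN : N ≠ 0) (x : ℝ) :
    (deriv (oscillation η N 0) x / N) ^ 2 + (deriv (oscillation η N (π / 2)) x / N) ^ 2 =
      η x ^ 2 + (deriv η x / N ^ 2) ^ 2 := by
  simp only [deriv_oscillation_div hη hN, add_zero, cos_add_pi_div_two, sin_add_pi_div_two]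
  linear_combination (η x ^ 2 + (deriv η x / N ^ 2) ^ 2) * sin_sq_add_cos_sq (N ^ 2 * x)

theorem tendsto_oscillation_atTop (η : ℝ → ℝ) (ϑ x : ℝ) :
    Tendsto (fun N => oscillation η N ϑ x) atTop (𝓝 0) :=
  squeeze_zero_norm' ((eventually_gt_atTop 0).mono fun _ hN => abs_oscillation_le hN ϑ x)
    (tendsto_id.const_div_atTop _)

theorem tendsto_phaseSum (hη : ContDiff ℝ 1 η) (hP : ContinuousAt P 0) (x : ℝ) :
    Tendsto (fun N => phaseSum η P N x) atTop (𝓝 (η x ^ 2 • P 0)) := by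
  have herror (ϑ : ℝ) : Tendsto (fun N => (deriv (oscillation η N ϑ) x / N) ^ 2 •
      (P (oscillation η N ϑ x) - P 0)) atTop (𝓝 0) := by
    have hdiff : Tendsto (fun N => P (oscillation η N ϑ x) - P 0) atTop (𝓝 0) := by
      simpa using (hP.tendsto.comp (tendsto_oscillation_atTop η ϑ x)).sub_const (P 0)
    have hbdd : ∀ᶠ N in atTop, ‖(deriv (oscillation η N ϑ) x / N) ^ 2‖ ≤
        (|η x| + |deriv η x|) ^ 2 := by
      filter_upwards [eventually_ge_atTop 1] with N hN
      rw [norm_pow]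
      exact pow_le_pow_left₀ (norm_nonneg _) (abs_deriv_oscillation_div_le hη hN ϑ x) 2
    exact (isBoundedUnder_of_eventually_le hbdd).smul_tendsto_zero hdiff
  have hmain : Tendsto (fun N => (η x ^ 2 + (deriv η x / N ^ 2) ^ 2) • P 0) atTop
      (𝓝 (η x ^ 2 • P 0)) := by
    have hslope : Tendsto (fun N => deriv η x / N ^ 2) atTop (𝓝 0) :=
      (tendsto_pow_atTop two_ne_zero).const_div_atTop _
    simpa using ((hslope.pow 2).const_add (η x ^ 2)).smul_const (P 0)
  have hsum := ((herror 0).add (herror (π / 2))).add hmain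
  rw [zero_add, zero_add] at hsum
  refine hsum.congr' ?_
  filter_upwards [eventually_ne_atTop 0] with N hN
  rw [← sq_deriv_oscillation_div_add_sq hη hN, phaseSum]
  module

theorem norm_phaseSum_le (hη : ContDiff ℝ 1 η) (hN : 1 ≤ N) {c : ℝ}
    (hc : ∀ ϑ, ‖P (oscillation η N ϑ x)‖ ≤ c) :
    ‖phaseSum η P N x‖ ≤ 2 * c * (|η x| + |deriv η x|) ^ 2 := by
  have hterm (ϑ : ℝ) : ‖(deriv (oscillation η N ϑ) x / N) ^ 2 • P (oscillation η N ϑ x)‖ ≤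
      (|η x| + |deriv η x|) ^ 2 * c := by
    rw [norm_smul, norm_pow]
    exact mul_le_mul (pow_le_pow_left₀ (norm_nonneg _) (abs_deriv_oscillation_div_le hη hN ϑ x) 2)
      (hc ϑ) (norm_nonneg _) (sq_nonneg _)
  calc ‖phaseSum η P N x‖ ≤ _ := norm_add_le _ _
    _ ≤ _ := add_le_add (hterm 0) (hterm (π / 2))
    _ = 2 * c * (|η x| + |deriv η x|) ^ 2 := by ring

theorem IsTestMap.eventually_abs_oscillation_le {I : Set ℝ} (hη : IsTestMap I η) (hδ : 0 < δ) :
    ∀ᶠ N in atTop, ∀ ϑ x, |oscillation η N ϑ x| ≤ δ := by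
  obtain ⟨C, hC⟩ := hη.2.1.exists_bound_of_continuous hη.1.continuous
  filter_upwards [eventually_ge_atTop (C / δ), eventually_gt_atTop 0] with N hN hN0 ϑ x
  calc |oscillation η N ϑ x| ≤ |η x| / N := abs_oscillation_le hN0 ϑ x
    _ ≤ C / N := by gcongr; exact hC x
    _ ≤ δ := (div_le_comm₀ hN0 hδ).2 hN

theorem isTestMap_oscillation {I : Set ℝ} (hη : IsTestMap I η) (N ϑ : ℝ) :
    IsTestMap I (oscillation η N ϑ) :=
  hη.of_support_subset (contDiff_oscillation hη.1 N ϑ) (support_oscillation_subset η N ϑ)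

end Oscillation

section OscillationIntegral

open Real

variable {V : Type*} [NormedAddCommGroup V] [InnerProductSpace ℝ V] {η : ℝ → ℝ} {P : ℝ → V}
  {N x δ : ℝ}

theorem IsTestMap.integrableOn_inner_sq_deriv_smul {I : Set ℝ} {β : ℝ → ℝ} (hβ : IsTestMap I β)
    (hP : ContinuousOn P (Icc (-δ) δ)) (hβδ : ∀ x, |β x| ≤ δ) (hI : IsOpen I) {h : ℝ → V}
    (hh : LocallyIntegrableOn h I) (c : ℝ) :
    IntegrableOn (fun x => ⟪(deriv β x / c) ^ 2 • P (β x), h x⟫) I := by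
  have hcont : Continuous fun x => (deriv β x / c) ^ 2 • P (β x) :=
    ((hβ.continuous_deriv.div_const c).pow 2).smul
      (hP.comp_continuous hβ.1.continuous fun x => abs_le.1 (hβδ x))
  have hsupp : Function.support (fun x => (deriv β x / c) ^ 2 • P (β x)) ⊆ tsupport β :=
    fun x hx => support_deriv_subset fun h0 => hx (by simp [h0])
  exact integrableOn_inner_of_tsupport_subset hcont (hβ.2.1.mono' hsupp)
    ((closure_minimal hsupp (isClosed_tsupport β)).trans hβ.2.2) hI hh

theorem inner_phaseSum (h : V) :
    ⟪phaseSum η P N x, h⟫ =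
      ⟪(deriv (oscillation η N 0) x / N) ^ 2 • P (oscillation η N 0 x), h⟫ +
        ⟪(deriv (oscillation η N (π / 2)) x / N) ^ 2 • P (oscillation η N (π / 2) x), h⟫ :=
  inner_add_left _ _ _

theorem IsTestMap.tendsto_integral_inner_phaseSum {I : Set ℝ} (hη : IsTestMap I η) (hδ : 0 < δ)
    (hP : ContinuousOn P (Icc (-δ) δ)) (hI : IsOpen I) {h : ℝ → V}
    (hh : LocallyIntegrableOn h I) :
    Tendsto (fun N => ∫ x in I, ⟪phaseSum η P N x, h x⟫) atTop
      (𝓝 (∫ x in I, ⟪η x ^ 2 • P 0, h x⟫)) := by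
  obtain ⟨c, hc⟩ := isCompact_Icc.exists_bound_of_continuousOn hP
  have hP0 : ContinuousAt P 0 := hP.continuousAt (Icc_mem_nhds (neg_lt_zero.2 hδ) hδ)
  have hsmall := hη.eventually_abs_oscillation_le hδ
  have hbound : IntegrableOn (fun x => 2 * c * (|η x| + |deriv η x|) ^ 2 * ‖h x‖) I := by
    have hcont : Continuous fun x => 2 * c * (|η x| + |deriv η x|) ^ 2 := by
      have := hη.continuous_deriv
      have := hη.1.continuous
      fun_prop
    have hsupp : Function.support (fun x => 2 * c * (|η x| + |deriv η x|) ^ 2) ⊆ tsupport η := by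
      refine Function.support_subset_iff'.2 fun x hx => ?_
      rw [image_eq_zero_of_notMem_tsupport hx,
        image_eq_zero_of_notMem_tsupport fun hx' => hx (tsupport_deriv_subset hx')]
      simp
    simpa only [RCLike.inner_apply, conj_trivial, mul_comm] using
      integrableOn_inner_of_tsupport_subset (𝕜 := ℝ) hcont (hη.2.1.mono' hsupp)
        ((closure_minimal hsupp (isClosed_tsupport η)).trans hη.2.2) hI hh.norm
  refine tendsto_integral_filter_of_dominated_convergence _ ?_ ?_ hbound ?_
  · filter_upwards [hsmall] with N hN
    have hint (ϑ : ℝ) :=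
      (isTestMap_oscillation hη N ϑ).integrableOn_inner_sq_deriv_smul hP (hN ϑ) hI hh N
    simp only [inner_phaseSum]
    exact ((hint 0).add (hint (π / 2))).1
  · filter_upwards [hsmall, eventually_ge_atTop 1] with N hN hN1
    refine ae_of_all _ fun x => (norm_inner_le_norm _ _).trans ?_
    gcongr
    exact norm_phaseSum_le hη.1 hN1 fun ϑ => hc _ (abs_le.1 (hN ϑ x))
  · exact ae_of_all _ fun x => (tendsto_phaseSum hη.1 hP0 x).inner tendsto_const_nhds

theorem IsTestMap.eventually_add_integral_inner_phaseSum_nonneg {I : Set ℝ} (hη : IsTestMap I η)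
    (hδ : 0 < δ) (hP : ContinuousOn P (Icc (-δ) δ)) (hI : IsOpen I) {h : ℝ → V}
    (hh : LocallyIntegrableOn h I) {C : ℝ}
    (H : ∀ β : ℝ → ℝ, ContDiff ℝ 1 β → tsupport β ⊆ tsupport η → (∀ x, |β x| ≤ δ) →
      0 ≤ C + ∫ x in I, deriv β x ^ 2 * ⟪P (β x), h x⟫) :
    ∀ᶠ N in atTop, 0 ≤ 2 * C / N ^ 2 + ∫ x in I, ⟪phaseSum η P N x, h x⟫ := by
  filter_upwards [hη.eventually_abs_oscillation_le hδ] with N hN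
  have hphase (ϑ : ℝ) : 0 ≤ C / N ^ 2 + ∫ x in I,
      ⟪(deriv (oscillation η N ϑ) x / N) ^ 2 • P (oscillation η N ϑ x), h x⟫ := by
    have hH := H _ (contDiff_oscillation hη.1 N ϑ)
      (closure_mono (support_oscillation_subset η N ϑ)) (hN ϑ)
    simpa only [real_inner_smul_left, div_pow, div_mul_eq_mul_div, integral_div, ← add_div] using
      div_nonneg hH (sq_nonneg N)
  have hint (ϑ : ℝ) :=
    (isTestMap_oscillation hη N ϑ).integrableOn_inner_sq_deriv_smul hP (hN ϑ) hI hh N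
  simp only [inner_phaseSum]
  rw [integral_add (hint 0) (hint (π / 2))]
  linear_combination hphase 0 + hphase (π / 2)

theorem IsTestMap.integral_inner_sq_smul_nonneg {I : Set ℝ} (hη : IsTestMap I η) (hδ : 0 < δ)
    (hP : ContinuousOn P (Icc (-δ) δ)) (hI : IsOpen I) {h : ℝ → V}
    (hh : LocallyIntegrableOn h I) {C : ℝ}
    (H : ∀ β : ℝ → ℝ, ContDiff ℝ 1 β → tsupport β ⊆ tsupport η → (∀ x, |β x| ≤ δ) →
      0 ≤ C + ∫ x in I, deriv β x ^ 2 * ⟪P (β x), h x⟫) :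
    0 ≤ ∫ x in I, ⟪η x ^ 2 • P 0, h x⟫ := by
  have hconst : Tendsto (fun N : ℝ => 2 * C / N ^ 2) atTop (𝓝 0) :=
    (tendsto_pow_atTop two_ne_zero).const_div_atTop _
  have hlim := hconst.add (hη.tendsto_integral_inner_phaseSum hδ hP hI hh)
  rw [zero_add] at hlim
  exact ge_of_tendsto hlim (hη.eventually_add_integral_inner_phaseSum_nonneg hδ hP hI hh H)

end OscillationIntegral

section Necessity

variable {V : Type*} [NormedAddCommGroup V] [InnerProductSpace ℝ V] {φ : ℝ → ℝ} {I : Set ℝ}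
  {T : ℝ → V →L[ℝ] V}

theorem locallyIntegrableOn_energyForm (hT : LocallyIntegrableOn T I) (φ : ℝ → ℝ) (v ξ : V) :
    LocallyIntegrableOn (fun x => energyForm φ (T x) v ξ) I :=
  fun x hx => ((innerSL ℝ (fderiv ℝ (radialMap φ) v ξ)).comp
    (ContinuousLinearMap.apply ℝ V ξ)).integrableAtFilter_comp (hT x hx)

theorem RegularWeight.ae_energyForm_nonneg (h : RegularWeight φ) (hI : IsOpen I)
    (hT : LocallyIntegrableOn T I) (hdiss : IsDissipative φ I T) {v : V} (hv : v ≠ 0) (ξ : V) :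
    ∀ᵐ x ∂volume.restrict I, 0 ≤ energyForm φ (T x) v ξ := by
  refine ae_nonneg_of_forall_sq_mul_nonneg hI (locallyIntegrableOn_energyForm hT φ v ξ)
    fun η hη hηc hηI => ?_
  obtain ⟨C, hC⟩ := h.exists_forall_add_integral_energyForm_nonneg hI hT hdiss hv ξ hηc hηI
  have hball : ∀ᶠ t : ℝ in 𝓝 0, v + t • ξ ≠ 0 := by
    refine ContinuousAt.eventually_ne (by fun_prop) ?_
    simpa using hv
  obtain ⟨δ, hδ, hne⟩ := Metric.nhds_basis_closedBall.eventually_iff.1 hball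
  rw [Real.closedBall_eq_Icc, zero_sub, zero_add] at hne
  have hP : ContinuousOn (fun t : ℝ => fderiv ℝ (radialMap φ) (v + t • ξ) ξ) (Icc (-δ) δ) :=
    (h.continuousOn_fderiv_radialMap.comp (by fun_prop) hne).clm_apply continuousOn_const
  have hnonneg := IsTestMap.integral_inner_sq_smul_nonneg ⟨hη, hηc, hηI⟩ hδ hP hI
    (locallyIntegrableOn_clm_apply hT hI (continuous_const (y := ξ)))
    fun β hβ hβη hβδ => hC β hβ hβη fun x => hne (abs_le.1 (hβδ x))
  simpa only [energyForm, zero_smul, add_zero, real_inner_smul_left] using hnonneg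

theorem RegularWeight.continuousOn_energyForm (h : RegularWeight φ) (T : V →L[ℝ] V) :
    ContinuousOn (fun z : V × V => energyForm φ T z.1 z.2) {z | z.1 ≠ 0} :=
  ((h.continuousOn_fderiv_radialMap.comp continuousOn_fst fun _ hz => hz).clm_apply
    continuousOn_snd).inner (T.continuous.comp continuous_snd).continuousOn

theorem RegularWeight.ae_forall_energyForm_nonneg [TopologicalSpace.SeparableSpace V]
    (h : RegularWeight φ) (hI : IsOpen I) (hT : LocallyIntegrableOn T I)
    (hdiss : IsDissipative φ I T) :
    ∀ᵐ x ∂volume.restrict I, ∀ v, v ≠ 0 → ∀ ξ, 0 ≤ energyForm φ (T x) v ξ := by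
  obtain ⟨D, hDc, hDd⟩ := TopologicalSpace.exists_countable_dense (V × V)
  have hae : ∀ᵐ x ∂volume.restrict I, ∀ z ∈ D, z.1 ≠ 0 → 0 ≤ energyForm φ (T x) z.1 z.2 :=
    (ae_ball_iff hDc).2 fun z _ => ae_all_iff.2 fun hz =>
      h.ae_energyForm_nonneg hI hT hdiss hz z.2
  filter_upwards [hae] with x hx v hv ξ
  by_contra! hneg
  have hopen : IsOpen ({z : V × V | z.1 ≠ 0} ∩ {z | energyForm φ (T x) z.1 z.2 < 0}) :=
    (h.continuousOn_energyForm (T x)).isOpen_inter_preimage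
      (isOpen_ne_fun continuous_fst continuous_const) isOpen_Iio
  obtain ⟨z, ⟨hz, hzneg⟩, hzD⟩ := hDd.inter_open_nonempty _ hopen ⟨(v, ξ), hv, hneg⟩
  exact (hx z hzD hz).not_gt hzneg

theorem RegularWeight.isDissipative_iff_ae [TopologicalSpace.SeparableSpace V] (h : RegularWeight φ)
    (hI : IsOpen I) (hT : LocallyIntegrableOn T I) :
    IsDissipative φ I T ↔
      ∀ᵐ x ∂volume.restrict I, ∀ v, v ≠ 0 → ∀ ξ, 0 ≤ energyForm φ (T x) v ξ :=
  ⟨h.ae_forall_energyForm_nonneg hI hT, h.isDissipative_of_ae⟩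

end Necessity

section Matrix

variable {m : ℕ} {M : Matrix (Fin m) (Fin m) ℝ} {φ : ℝ → ℝ} {I : Set ℝ}
  {A : ℝ → Matrix (Fin m) (Fin m) ℝ}

/-- The operator on `ℂ^m`, seen as a real inner product space, of a real matrix `M`. -/
def realOp (M : Matrix (Fin m) (Fin m) ℝ) :
    EuclideanSpace ℂ (Fin m) →L[ℝ] EuclideanSpace ℂ (Fin m) :=
  (Matrix.toEuclideanCLM (𝕜 := ℂ) (M.map Complex.ofReal)).restrictScalars ℝ

theorem re_inner_complex (x y : EuclideanSpace ℂ (Fin m)) : (inner ℂ x y).re = ⟪x, y⟫ := by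
  simp only [PiLp.inner_apply, Complex.re_sum]
  rfl

theorem realOp_apply_re (M : Matrix (Fin m) (Fin m) ℝ) (z : EuclideanSpace ℂ (Fin m)) :
    (fun i => (realOp M z i).re) = M.mulVec fun i => (z i).re := by
  ext i
  simp [realOp, Matrix.mulVec, dotProduct]

theorem realOp_apply_im (M : Matrix (Fin m) (Fin m) ℝ) (z : EuclideanSpace ℂ (Fin m)) :
    (fun i => (realOp M z i).im) = M.mulVec fun i => (z i).im := by
  ext i
  simp [realOp, Matrix.mulVec, dotProduct]

theorem isSymmetric_realOp (hM : M.IsSymm) : (realOp M).toLinearMap.IsSymmetric := by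
  have hherm : (M.map Complex.ofReal).IsHermitian :=
    (Matrix.isHermitian_iff_isSymm.2 hM).map _ fun r => (Complex.conj_ofReal r).symm
  intro x y
  have hself : inner ℂ (realOp M x) y = inner ℂ x (realOp M y) :=
    (hherm.isSelfAdjoint.map (Matrix.toEuclideanCLM (𝕜 := ℂ) (n := Fin m))).isSymmetric x y
  have hre := congrArg Complex.re hself
  rwa [re_inner_complex, re_inner_complex] at hre

theorem hasEigenvalue_realOp_iff {t : ℝ} :
    Module.End.HasEigenvalue (realOp M).toLinearMap t ↔
      Module.End.HasEigenvalue (Matrix.toLin' M) t := by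
  constructor
  · intro ht
    obtain ⟨z, hz⟩ := ht.exists_hasEigenvector
    have heq : realOp M z = t • z := hz.apply_eq_smul
    have hre : M.mulVec (fun i => (z i).re) = t • fun i => (z i).re := by
      rw [← realOp_apply_re, heq]
      ext i
      simp
    have him : M.mulVec (fun i => (z i).im) = t • fun i => (z i).im := by
      rw [← realOp_apply_im, heq]
      ext i
      simp
    by_cases hz0 : (fun i => (z i).re) = 0
    · refine Module.End.hasEigenvalue_of_hasEigenvector (x := fun i => (z i).im)
        (Module.End.hasEigenvector_iff.2 ⟨Module.End.mem_eigenspace_iff.2 him, fun hz1 => hz.2 ?_⟩)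
      ext i
      exact Complex.ext (congrFun hz0 i) (congrFun hz1 i)
    · exact Module.End.hasEigenvalue_of_hasEigenvector
        (Module.End.hasEigenvector_iff.2 ⟨Module.End.mem_eigenspace_iff.2 hre, hz0⟩)
  · intro ht
    obtain ⟨w, hw⟩ := ht.exists_hasEigenvector
    have heq : M.mulVec w = t • w := hw.apply_eq_smul
    refine Module.End.hasEigenvalue_of_hasEigenvector
      (x := (WithLp.toLp 2 fun i => (w i : ℂ) : EuclideanSpace ℂ (Fin m)))
      (Module.End.hasEigenvector_iff.2 ⟨Module.End.mem_eigenspace_iff.2 ?_, fun hw0 => hw.2 ?_⟩)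
    · ext i
      refine Complex.ext ?_ ?_
      · simpa [heq] using congrFun (realOp_apply_re M (WithLp.toLp 2 fun i => (w i : ℂ))) i
      · simpa [heq, ← Pi.zero_def] using
          congrFun (realOp_apply_im M (WithLp.toLp 2 fun i => (w i : ℂ))) i
    · ext i
      exact Complex.ofReal_injective (congrArg (fun z => z i) hw0)

theorem pos_of_hasEigenvalue_toLin' (hM : ∀ ξ : Fin m → ℝ, ξ ≠ 0 → 0 < M.mulVec ξ ⬝ᵥ ξ) {t : ℝ}
    (ht : Module.End.HasEigenvalue (Matrix.toLin' M) t) : 0 < t := by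
  obtain ⟨w, hw⟩ := ht.exists_hasEigenvector
  have hpos := hM w hw.2
  rw [← Matrix.toLin'_apply, hw.apply_eq_smul, smul_dotProduct, smul_eq_mul] at hpos
  exact pos_of_mul_pos_left hpos (Finset.sum_nonneg fun i _ => mul_self_nonneg (w i))

theorem setOf_hasEigenvalue_eq_range (hM : M.IsHermitian) :
    {t : ℝ | Module.End.HasEigenvalue (Matrix.toLin' M) t} = range hM.eigenvalues := by
  rw [← hM.spectrum_real_eq_range_eigenvalues, ← Matrix.spectrum_toLin']
  ext t
  exact Module.End.hasEigenvalue_iff_mem_spectrum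

theorem isLeast_minEigenvalue [NeZero m] (hM : M.IsSymm) :
    IsLeast {t : ℝ | Module.End.HasEigenvalue (Matrix.toLin' M) t} (minEigenvalue M) := by
  rw [minEigenvalue, setOf_hasEigenvalue_eq_range (Matrix.isHermitian_iff_isSymm.2 hM)]
  exact ⟨(range_nonempty _).csInf_mem (finite_range _),
    fun _ ht => csInf_le (finite_range _).bddBelow ht⟩

theorem isGreatest_maxEigenvalue [NeZero m] (hM : M.IsSymm) :
    IsGreatest {t : ℝ | Module.End.HasEigenvalue (Matrix.toLin' M) t} (maxEigenvalue M) := by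
  rw [maxEigenvalue, setOf_hasEigenvalue_eq_range (Matrix.isHermitian_iff_isSymm.2 hM)]
  exact ⟨(range_nonempty _).csSup_mem (finite_range _),
    fun _ ht => le_csSup (finite_range _).bddAbove ht⟩

theorem range_eigenvalues_fin_two {M : Matrix (Fin 2) (Fin 2) ℝ} (hM : M.IsHermitian) :
    range hM.eigenvalues = {hM.eigenvalues 0, hM.eigenvalues 1} := by
  ext t
  simp [Fin.exists_fin_two, eq_comm]

theorem minEigenvalue_add_maxEigenvalue {M : Matrix (Fin 2) (Fin 2) ℝ} (hM : M.IsSymm) :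
    minEigenvalue M + maxEigenvalue M = M.trace := by
  have hherm := Matrix.isHermitian_iff_isSymm.2 hM
  rw [minEigenvalue, maxEigenvalue, setOf_hasEigenvalue_eq_range hherm,
    range_eigenvalues_fin_two, csInf_pair, csSup_pair, min_add_max,
    hherm.trace_eq_sum_eigenvalues, Fin.sum_univ_two]
  rfl

theorem minEigenvalue_mul_maxEigenvalue {M : Matrix (Fin 2) (Fin 2) ℝ} (hM : M.IsSymm) :
    minEigenvalue M * maxEigenvalue M = M.det := by
  have hherm := Matrix.isHermitian_iff_isSymm.2 hM
  rw [minEigenvalue, maxEigenvalue, setOf_hasEigenvalue_eq_range hherm,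
    range_eigenvalues_fin_two, csInf_pair, csSup_pair, min_mul_max,
    hherm.det_eq_prod_eigenvalues, Fin.prod_univ_two]
  rfl

theorem locallyIntegrableOn_sum {ι W : Type*} [NormedAddCommGroup W] {s : Finset ι}
    {f : ι → ℝ → W} (hf : ∀ i ∈ s, LocallyIntegrableOn (f i) I) :
    LocallyIntegrableOn (∑ i ∈ s, f i) I :=
  Finset.sum_induction f (LocallyIntegrableOn · I) (fun _ _ => .add) locallyIntegrableOn_zero hf

theorem locallyIntegrableOn_realOp
    (hA : ∀ i j, LocallyIntegrableOn (fun x => A x i j) I) :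
    LocallyIntegrableOn (fun x => realOp (A x)) I := by
  have hexp : (fun x => realOp (A x)) =
      ∑ i, ∑ j, fun x => A x i j • realOp (Matrix.single i j 1) := by
    ext x z k
    simp [realOp, Matrix.mulVec, dotProduct, Matrix.single_apply, ite_and, apply_ite Complex.ofReal]
  rw [hexp]
  refine locallyIntegrableOn_sum fun i _ => locallyIntegrableOn_sum fun j _ x hx => ?_
  exact ((ContinuousLinearMap.id ℝ ℝ).smulRight (realOp (Matrix.single i j 1)))
    |>.integrableAtFilter_comp (hA i j x hx)

theorem lPhiDissipative_iff_isDissipative (hI : IsOpen I)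
    (hA : LocallyIntegrableOn (fun x => realOp (A x)) I) :
    LPhiDissipative φ I (fun x => (A x).map Complex.ofReal) ↔
      IsDissipative φ I fun x => realOp (A x) := by
  refine forall_congr' fun u => forall_congr' fun hu => forall_congr' fun hw => ?_
  have hint := integrableOn_inner_of_tsupport_subset (𝕜 := ℂ) (hw.1.continuous_deriv le_rfl)
    hw.2.1.deriv (tsupport_deriv_subset.trans hw.2.2) hI
    (locallyIntegrableOn_clm_apply hA hI (hu.1.continuous_deriv le_rfl))
  have hre := integral_re hint
  simp only [RCLike.re_eq_complex_re, re_inner_complex] at hre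
  exact (congrArg (0 ≤ ·) hre).symm.to_iff

theorem RegularWeight.forall_forall_energyForm_realOp_nonneg_iff [NeZero m] (h : RegularWeight φ)
    (hM : M.IsSymm) (hpos : ∀ ξ : Fin m → ℝ, ξ ≠ 0 → 0 < M.mulVec ξ ⬝ᵥ ξ) :
    (∀ v, v ≠ 0 → ∀ ξ, 0 ≤ energyForm φ (realOp M) v ξ) ↔
      LambdaInftySq φ * (minEigenvalue M + maxEigenvalue M) ^ 2 ≤
        4 * (minEigenvalue M * maxEigenvalue M) := by
  have hmin := isLeast_minEigenvalue hM
  refine h.forall_forall_energyForm_nonneg_iff (isSymmetric_realOp hM) ?_ ?_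
    (pos_of_hasEigenvalue_toLin' hpos hmin.1)
  · simpa only [hasEigenvalue_realOp_iff] using hmin
  · simpa only [hasEigenvalue_realOp_iff] using isGreatest_maxEigenvalue hM

theorem isOpen_openInterval (a b : EReal) : IsOpen (openInterval a b) :=
  (isOpen_Ioo (a := a) (b := b)).preimage continuous_coe_real_ereal

end Matrix

end PhiDissipativity

end

open PhiDissipativity in
theorem mainTheorem6_general {φ : ℝ → ℝ} (hφ : RegularWeight φ) {I : Set ℝ} (hI : IsOpen I)
    {m : ℕ} (hm : 1 ≤ m) {A : ℝ → Matrix (Fin m) (Fin m) ℝ}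
    (hAint : ∀ i j, LocallyIntegrableOn (fun x => A x i j) I volume)
    (hApos : ∀ᵐ x ∂(volume.restrict I), (A x).IsSymm ∧
      ∀ ξ : Fin m → ℝ, ξ ≠ 0 → 0 < (A x).mulVec ξ ⬝ᵥ ξ) :
    (LPhiDissipative φ I (fun x => (A x).map Complex.ofReal) ↔
      ∀ᵐ x ∂(volume.restrict I),
        LambdaInftySq φ * (minEigenvalue (A x) + maxEigenvalue (A x)) ^ 2 ≤
          4 * (minEigenvalue (A x) * maxEigenvalue (A x))) ∧
    (m = 2 →
      ((∀ᵐ x ∂(volume.restrict I),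
        LambdaInftySq φ * (minEigenvalue (A x) + maxEigenvalue (A x)) ^ 2 ≤
          4 * (minEigenvalue (A x) * maxEigenvalue (A x))) ↔
      ∀ᵐ x ∂(volume.restrict I),
        LambdaInftySq φ * (A x).trace ^ 2 ≤ 4 * (A x).det)) := by
  have : NeZero m := ⟨Nat.one_le_iff_ne_zero.1 hm⟩
  have hT := locallyIntegrableOn_realOp hAint
  refine ⟨?_, ?_⟩
  · rw [lPhiDissipative_iff_isDissipative hI hT, hφ.isDissipative_iff_ae hI hT]
    exact eventually_congr <| hApos.mono fun x hx =>
      hφ.forall_forall_energyForm_realOp_nonneg_iff hx.1 hx.2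
  · rintro rfl
    refine eventually_congr <| hApos.mono fun x hx => ?_
    rw [minEigenvalue_add_maxEigenvalue hx.1, minEigenvalue_mul_maxEigenvalue hx.1]

open PhiDissipativity in
theorem mainTheorem6 (φ : ℝ → ℝ) (hφ : AdmissibleWeight φ) (a b : EReal) (hab : a < b)
    (m : ℕ) (hm : 1 ≤ m) (A : ℝ → Matrix (Fin m) (Fin m) ℝ)
    (hAint : ∀ i j, LocallyIntegrableOn (fun x => A x i j) (openInterval a b) volume)
    (hApos : ∀ᵐ x ∂(volume.restrict (openInterval a b)), (A x).IsSymm ∧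
      ∀ ξ : Fin m → ℝ, ξ ≠ 0 → 0 < (A x).mulVec ξ ⬝ᵥ ξ) :
    (LPhiDissipative φ (openInterval a b) (fun x => (A x).map Complex.ofReal) ↔
      ∀ᵐ x ∂(volume.restrict (openInterval a b)),
        LambdaInftySq φ * (minEigenvalue (A x) + maxEigenvalue (A x)) ^ 2 ≤
          4 * (minEigenvalue (A x) * maxEigenvalue (A x))) ∧
    (m = 2 →
      ((∀ᵐ x ∂(volume.restrict (openInterval a b)),
        LambdaInftySq φ * (minEigenvalue (A x) + maxEigenvalue (A x)) ^ 2 ≤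
          4 * (minEigenvalue (A x) * maxEigenvalue (A x))) ↔
      ∀ᵐ x ∂(volume.restrict (openInterval a b)),
        LambdaInftySq φ * (A x).trace ^ 2 ≤ 4 * (A x).det)) :=
  mainTheorem6_general hφ.regularWeight (isOpen_openInterval a b) hm hAint hApos
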